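/- Let $N\ge 2$, let the data universe be $\mathcal X=\{0,\dots,N-1\}$, and put $d=\lceil\log_2 N\rceil$. For a dataset $D\in\mathcal X^n$ let $f(D)$ be its mode (the most frequent element, ties being broken towards the smallest element), let $\mathrm{occ}_1$ be the number of occurrences of $f(D)$, and let $\mathrm{occ}_2$ be the largest number of occurrences of an element other than $f(D)$. Fix $\bot\in\mathcal X$, and write $\mathrm{Lap}(b)$ for the Laplace distribution with density $\frac1{2b}e^{-|x|/b}$. The pure-DP mode-release algorithm with parameter $\varepsilon>0$ does the following on input $D$. 1. Let $\delta$ be given by $\log(1/\delta)=d\log(2d^3/\varepsilon)$. Draw $Z\sim\mathrm{Lap}(1/\varepsilon)$. If $\lceil(\mathrm{occ}_1-\mathrm{occ}_2)/2\rceil-1+Z\le\log(1/\delta)/\varepsilon$, set $u_{\mathrm{apx}}=\bot$; otherwise set $u_{\mathrm{apx}}=f(D)$. 2. Let $z\in\{0,1\}^d$ be the binary representation of $u_{\mathrm{apx}}$, let $\omega=2^{-d}$ and $\Delta=2d\,(\delta/(2\omega))^{1/d}$. With probability $1-\omega$ let $x=z$; otherwise draw $x$ uniformly from $[0,1]^d$.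 Add independent $\mathrm{Lap}(2\Delta/\varepsilon)$ noise to each coordinate of $x$, and round each coordinate to $1$ if it is at least $1/2$ and to $0$ otherwise. Return the element of $\mathcal X$ with this binary representation (or $\bot$ if the number represented is not less than $N$). Then the following hold. (a) For all $N\ge2$, $n$, $\bot$ and $\varepsilon>0$ the algorithm is $2\varepsilon$-differentially private: for all $D,D'\in\mathcal X^n$ that differ in at most one entry and every $S\subseteq\mathcal X$, the output $\mathcal M$ satisfies $\mathbb P[\mathcal M(D)\in S]\le e^{2\varepsilon}\,\mathbb P[\mathcal M(D')\in S]$. (b) It runs in time $\mathcal O(n+\log|\mathcal X|)$: there are a single program for a unit-cost randomized random access machine (with zero-initialized memory; natural-number registers with addition, truncated subtraction, halving and comparison; real registers with arithmetic, $\exp$, $\log$ and comparison; and drawing of a uniform or a Laplace random number) and an absolute constant $C$ such that for all $N\ge2$, $n$, $\bot$, $\varepsilon>0$ and $D\in\mathcal X^n$ the program always halts after at most $C(n+\log|\mathcal X|)$ steps, and its output has exactly the distribution of the output of the algorithm. (c) There is an absolute constant $K$ such that for all $\varepsilon_0>0$ and $c>1$ there is a constant $C$, depending only on $\varepsilon_0$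 and $c$, with the following property. For all $N\ge 2$, $n$, $\bot$, $D\in\mathcal X^n$ and $0<\varepsilon\le\varepsilon_0$ with $\log|\mathcal X|\ge c\,\varepsilon$, if $$\mathrm{occ}_1-\mathrm{occ}_2> C\,\frac{\log|\mathcal X|\,\log(\log|\mathcal X|/\varepsilon)}{\varepsilon},$$ then the algorithm returns the mode $f(D)$ with probability at least $1-K/|\mathcal X|$. (For instance, one constant $C$ serves all $\varepsilon\le1$ and $|\mathcal X|\ge3$.) -/

import Mathlib

open MeasureTheory ProbabilityTheory
open scoped ENNReal

namespace ModeRelease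

/-! ### Differential privacy -/

/-- A mechanism `M` maps a dataset of `n` records to the law `M D` of its random output.  It is
`(ε, δ)`-differentially private if for all datasets differing in at most one entry and every event
`S`, `P[M D ∈ S] ≤ exp ε * P[M D' ∈ S] + δ`. -/
def IsDP {n : ℕ} {X Y : Type*} [DecidableEq X] [MeasurableSpace Y] (ε δ : ℝ)
    (M : (Fin n → X) → Measure Y) : Prop :=
  (∀ D, IsProbabilityMeasure (M D)) ∧
    ∀ D D' : Fin n → X, hammingDist D D' ≤ 1 → ∀ S : Set Y, MeasurableSet S →
      M D S ≤ ENNReal.ofReal (Real.exp ε) * M D' S + ENNReal.ofReal δ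

/-! ### Laplace noise and purification on `ℝ^d` -/

/-- The centred Laplace distribution with scale `b`. -/
noncomputable def laplace (b : ℝ) : Measure ℝ :=
  volume.withDensity fun x => ENNReal.ofReal (Real.exp (-|x| / b) / (2 * b))

/-- `Δ = 2 d^(1 - 1/q) R (δ / (2ω))^(1/d)`. -/
noncomputable def purifyDelta (d : ℕ) (q : ℝ≥0∞) (R δ ω : ℝ) : ℝ :=
  2 * (d : ℝ) ^ (1 - (1 / q).toReal) * R * (δ / (2 * ω)) ^ (1 / (d : ℝ))

/-- The law of `x + Laplace^{⊗d}(2Δ/ε')`, where `x` has law `μ` with probability `1 - ω` and is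
uniform on `Θ` with probability `ω`.  Here `Θ` is an `ℓ_q` ball of diameter `R`. -/
noncomputable def purify {d : ℕ} (μ : Measure (Fin d → ℝ)) (Θ : Set (Fin d → ℝ)) (q : ℝ≥0∞)
    (R ε' δ ω : ℝ) : Measure (Fin d → ℝ) :=
  (ENNReal.ofReal (1 - ω) • μ + ENNReal.ofReal ω • cond volume Θ) ∗
    Measure.pi fun _ : Fin d => laplace (2 * purifyDelta d q R δ ω / ε')

/-! ### Purification on the finite space `{0, …, N - 1}` through the binary embedding -/

/-- The number of bits, `⌈log₂ N⌉`. -/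
def bits (N : ℕ) : ℕ := Nat.clog 2 N

/-- The binary representation of `u` as a vertex of the cube (least significant bit first). -/
def binMap {N : ℕ} (u : Fin N) : Fin (bits N) → ℝ :=
  fun i => if (u : ℕ).testBit i then 1 else 0

/-- Coordinatewise rounding to `{0, 1}^d`, at the threshold `1/2`. -/
noncomputable def roundCube {d : ℕ} (z : Fin d → ℝ) : Fin d → Bool :=
  fun i => decide (1 / 2 ≤ z i)

/-- Decoding of a binary word; the words that are not in the range of `binMap`, which exist only
if `N` is not a power of two, are decoded as `bot`. -/
def decode {N : ℕ} (bot : Fin N) (w : Fin (bits N) → Bool) : Fin N :=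
  if h : Nat.ofBits w < N then ⟨Nat.ofBits w, h⟩ else bot

/-- Binary embedding purification of an output with law `μ`.  The cube `[0, 1]^d` is the `ℓ_∞` ball
of diameter `1`; the mixture level is `2^{-d}`. -/
noncomputable def purifyDiscrete {N : ℕ} (ε δ : ℝ) (bot : Fin N) (μ : Measure (Fin N)) :
    Measure (Fin N) :=
  (purify (μ.map binMap) (Set.Icc 0 1) ∞ 1 ε δ ((2 : ℝ)⁻¹ ^ bits N)).map
    fun z => decode bot (roundCube z)

/-! ### Mode release -/

/-- The number of occurrences of `x` in `D`. -/
def freq {n N : ℕ} (D : Fin n → Fin N) (x : Fin N) : ℕ :=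
  (Finset.univ.filter fun i => D i = x).card

/-- The most frequent elements of `D`. -/
def modes {n N : ℕ} (D : Fin n → Fin N) : Finset (Fin N) :=
  Finset.univ.filter fun x => ∀ y, freq D y ≤ freq D x

theorem modes_nonempty {n N : ℕ} [NeZero N] (D : Fin n → Fin N) : (modes D).Nonempty := by
  obtain ⟨x, -, hx⟩ := Finset.exists_max_image Finset.univ (freq D) ⟨0, Finset.mem_univ _⟩
  exact ⟨x, by simpa [modes] using hx⟩

/-- The mode of `D`, ties being broken towards the smallest element. -/
def mode {n N : ℕ} [NeZero N] (D : Fin n → Fin N) : Fin N :=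
  (modes D).min' (modes_nonempty D)

/-- The frequency of the most frequent item. -/
def occ₁ {n N : ℕ} [NeZero N] (D : Fin n → Fin N) : ℕ := freq D (mode D)

/-- The frequency of the second most frequent item, i.e. the largest frequency of an item other
than the mode. -/
def occ₂ {n N : ℕ} [NeZero N] (D : Fin n → Fin N) : ℕ :=
  (Finset.univ.erase (mode D)).sup (freq D)

/-- `log (1/δ) = d log (2 d³ / ε)` with `d = ⌈log₂ N⌉`. -/
noncomputable def logInvDelta (N : ℕ) (ε : ℝ) : ℝ :=
  bits N * Real.log (2 * (bits N : ℝ) ^ 3 / ε)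

/-- The distance to instability `⌈(occ₁ - occ₂) / 2⌉`. -/
noncomputable def instabilityDist {n N : ℕ} [NeZero N] (D : Fin n → Fin N) : ℤ :=
  ⌈((occ₁ D : ℝ) - occ₂ D) / 2⌉

/-- The law of the output of the distance-to-instability test; the failure symbol `⊥` is
represented by a fixed element `bot` of the universe. -/
noncomputable def approxMode {n N : ℕ} [NeZero N] (ε : ℝ) (bot : Fin N) (D : Fin n → Fin N) :
    Measure (Fin N) :=
  (laplace (1 / ε)).map fun z =>
    if (instabilityDist D : ℝ) - 1 + z ≤ logInvDelta N ε / ε then bot else mode D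

/-- The law of the output of the pure DP mode release algorithm. -/
noncomputable def modeRelease {n N : ℕ} [NeZero N] (ε : ℝ) (bot : Fin N) (D : Fin n → Fin N) :
    Measure (Fin N) :=
  purifyDiscrete ε (Real.exp (-logInvDelta N ε)) bot (approxMode ε bot D)

/-! ### Running time: a randomized random access machine with unit costs

The machine has registers and a memory for natural numbers, the memory being addressed indirectly
through the registers, and registers for real numbers.  Every instruction, including the drawing of
one uniform or one Laplace random number, costs one step. -/

/-- The instructions; `i`, `j`, `k` are numbers of registers and `l` is a program line. -/
inductive Instr where
  /-- natural registers: `rᵢ := c` -/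
  | const (i c : ℕ)
  /-- `rᵢ := rⱼ + rₖ` -/
  | add (i j k : ℕ)
  /-- `rᵢ := max (rⱼ - rₖ) 0` -/
  | sub (i j k : ℕ)
  /-- `rᵢ := ⌊rⱼ / 2⌋` -/
  | half (i j : ℕ)
  /-- `rᵢ := mem[rⱼ]` -/
  | load (i j : ℕ)
  /-- `mem[rᵢ] := rⱼ` -/
  | store (i j : ℕ)
  /-- the real register `xᵢ := rⱼ` -/
  | cast (i j : ℕ)
  /-- `xᵢ := xⱼ + xₖ` -/
  | addR (i j k : ℕ)
  /-- `xᵢ := xⱼ - xₖ` -/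
  | subR (i j k : ℕ)
  /-- `xᵢ := xⱼ * xₖ` -/
  | mulR (i j k : ℕ)
  /-- `xᵢ := xⱼ / xₖ` -/
  | divR (i j k : ℕ)
  /-- `xᵢ := exp xⱼ` -/
  | expR (i j : ℕ)
  /-- `xᵢ := log xⱼ` -/
  | logR (i j : ℕ)
  /-- `xᵢ :=` a fresh random number, uniform on `[0, 1]` -/
  | drawUnif (i : ℕ)
  /-- `xᵢ :=` a fresh random number with the Laplace distribution of scale `1` -/
  | drawLap (i : ℕ)
  /-- go to line `l` -/
  | jump (l : ℕ)
  /-- go to line `l` if `rᵢ ≤ rⱼ` -/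
  | jumpLE (i j l : ℕ)
  /-- go to line `l` if `xᵢ ≤ xⱼ` -/
  | jumpLER (i j l : ℕ)

/-- A configuration of the machine; `draws` counts the entries of the random tape already read. -/
structure Config where
  pc : ℕ
  reg : ℕ → ℕ
  mem : ℕ → ℕ
  xreg : ℕ → ℝ
  draws : ℕ

/-- A random tape: each entry holds a uniform and a Laplace random number. -/
abbrev Tape : Type := ℕ → ℝ × ℝ

/-- The law of the tape: all the numbers on it are independent. -/
noncomputable def tapeLaw : Measure Tape :=
  Measure.infinitePi fun _ : ℕ => (volume.restrict (Set.Icc (0 : ℝ) 1)).prod (laplace 1)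

namespace Config

/-- Proceed to the next line. -/
def next (s : Config) : Config := { s with pc := s.pc + 1 }

/-- Assign a natural register. -/
def setReg (s : Config) (i v : ℕ) : Config := { s with reg := Function.update s.reg i v }

/-- Assign a real register. -/
noncomputable def setX (s : Config) (i : ℕ) (v : ℝ) : Config :=
  { s with xreg := Function.update s.xreg i v }

end Config

/-- The effect of one instruction. -/
noncomputable def Instr.exec (τ : Tape) (s : Config) : Instr → Config
  | .const i c => (s.setReg i c).next
  | .add i j k => (s.setReg i (s.reg j + s.reg k)).next
  | .sub i j k => (s.setReg i (s.reg j - s.reg k)).next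
  | .half i j => (s.setReg i (s.reg j / 2)).next
  | .load i j => (s.setReg i (s.mem (s.reg j))).next
  | .store i j => { s with mem := Function.update s.mem (s.reg i) (s.reg j) }.next
  | .cast i j => (s.setX i (s.reg j)).next
  | .addR i j k => (s.setX i (s.xreg j + s.xreg k)).next
  | .subR i j k => (s.setX i (s.xreg j - s.xreg k)).next
  | .mulR i j k => (s.setX i (s.xreg j * s.xreg k)).next
  | .divR i j k => (s.setX i (s.xreg j / s.xreg k)).next
  | .expR i j => (s.setX i (Real.exp (s.xreg j))).next
  | .logR i j => (s.setX i (Real.log (s.xreg j))).next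
  | .drawUnif i => { s.setX i (τ s.draws).1 with draws := s.draws + 1 }.next
  | .drawLap i => { s.setX i (τ s.draws).2 with draws := s.draws + 1 }.next
  | .jump l => { s with pc := l }
  | .jumpLE i j l => if s.reg i ≤ s.reg j then { s with pc := l } else s.next
  | .jumpLER i j l => if s.xreg i ≤ s.xreg j then { s with pc := l } else s.next

/-- A program is a finite list of instructions; the machine has halted when the program counter
points beyond it. -/
def Halted (P : List Instr) (s : Config) : Prop := P.length ≤ s.pc

/-- One step of the machine; a halted machine does not move. -/
noncomputable def step (P : List Instr) (τ : Tape) (s : Config) : Config :=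
  match P[s.pc]? with
  | some I => I.exec τ s
  | none => s

/-- The configuration after `t` steps. -/
noncomputable def run (P : List Instr) (τ : Tape) (s : Config) (t : ℕ) : Config :=
  (step P τ)^[t] s

/-- The input configuration: `n`, `N`, `bot` in the first three registers, `ε` in the first real
register, the `n` records in the first `n` memory cells, and zeros elsewhere. -/
noncomputable def input {n N : ℕ} (ε : ℝ) (bot : Fin N) (D : Fin n → Fin N) : Config where
  pc := 0
  reg i := if i = 0 then n else if i = 1 then N else if i = 2 then (bot : ℕ) else 0
  mem i := if h : i < n then (D ⟨i, h⟩ : ℕ) else 0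
  xreg i := if i = 0 then ε else 0
  draws := 0

/-- Within `T` steps, whatever the random tape, the program `P` halts on the given input, and the
content of its first register is then distributed according to `μ`. -/
def ComputesWithin {n N : ℕ} (P : List Instr) (ε : ℝ) (bot : Fin N) (D : Fin n → Fin N) (T : ℕ)
    (μ : Measure (Fin N)) : Prop :=
  (∀ τ, Halted P (run P τ (input ε bot D) T)) ∧
    tapeLaw.map (fun τ => (run P τ (input ε bot D) T).reg 0) = μ.map fun x : Fin N => (x : ℕ)

end ModeRelease

namespace ModeRelease

/-! ### The Laplace distribution -/

/-! Write d for the number of bits, ω = 2^(-d), b for the noise scale, p for the probability that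
the test passes, and h(x) for the probability that x plus noise is rounded into the words that
decode to a given event (`hitProb`). By `modeRelease_apply` the event has probability (1-ω)(p
h(mode) + (1-p) h(bot)) + ω ∫ h, with the integral over the unit cube, and log h is 1/b-Lipschitz in
the ℓ₁ norm (`hitProb_le`). Put r = (δ/(2ω))^(1/d) (`cubeSide`). The parameters are such that ω r^d
= δ/2 and d r / b = ε/4, while b depends on d only.

Privacy holds even with the factor exp ε, in three cases. If neighbouring datasets have the same
mode, the gap moves by at most 2, its rounded half by at most 1, and the test alone changes p and
1-p by a factor of at most exp ε. If the modes differ, both distances to instability are at most 1.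
For r ≤ 1 both pass probabilities are then at most δ/2 = ω r^d, the mass that the uniform part gives
to a cube of side r. Such a mass is moved from one vertex to another by a relay along a chain of k
cubes of side 1/k, with r ≤ 1/k ≤ 2r: the vertex hands its mass to the first cube, every cube to the
next one, and the last cube to the target vertex. All these moves happen at once and each has ℓ₁
length at most d/k, so the total price is a single factor exp(d/(k b)) ≤ exp(ε/2), however far apart
the vertices are (`mul_add_lintegral_le`). Moving the mass at the mode of D to bot, and then from
bot to the mode of D', pays this factor twice. Finally, if r > 1, the noise is so large that h
varies over the whole cube by a factor of at most exp(ε/4).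

For the running time, an explicit program is executed symbolically with loop invariants
(`reach_modeProgram`). The counters live in zero-initialized memory and are visited only through the
records, so the universe is never scanned. The result is a deterministic function of finitely many
distinct entries of the tape, and `measurePreserving_output` identifies its law.

For utility, the mode is returned if the uniform part is not chosen, the test passes and no bit is
flipped. The first two fail with probability at most 1/N each. A bit flips with probability at most
exp(-d²/16), which beats both the number of bits and N ≤ exp d (`mul_exp_neg_inv_noiseScale_le`). -/

theorem laplace_Ioi {b t : ℝ} (hb : 0 < b) (ht : 0 ≤ t) :
    laplace b (Set.Ioi t) = ENNReal.ofReal (Real.exp (-t / b) / 2) := by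
  rw [laplace, withDensity_apply _ measurableSet_Ioi]
  have h1 : ∫⁻ x in Set.Ioi t, ENNReal.ofReal (Real.exp (-|x| / b) / (2 * b)) =
      ∫⁻ x in Set.Ioi t, ENNReal.ofReal (Real.exp (-(1 / b) * x) / (2 * b)) := by
    refine setLIntegral_congr_fun measurableSet_Ioi fun x hx => ?_
    have : 0 ≤ x := ht.trans (le_of_lt hx)
    simp only [abs_of_nonneg this]
    congr 3
    ring
  have hneg : -(1 / b) < 0 := by simpa using hb
  rw [h1, ← ofReal_integral_eq_lintegral_ofReal]
  · rw [integral_div, integral_exp_mul_Ioi hneg]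
    congr 1
    rw [show -(1 / b) * t = -t / b by ring]
    field_simp
  · exact (integrableOn_exp_mul_Ioi hneg t).div_const _
  · exact Filter.Eventually.of_forall fun x => by positivity

theorem laplace_Iic {b t : ℝ} (hb : 0 < b) (ht : t ≤ 0) :
    laplace b (Set.Iic t) = ENNReal.ofReal (Real.exp (t / b) / 2) := by
  rw [laplace, withDensity_apply _ measurableSet_Iic]
  have h1 : ∫⁻ x in Set.Iic t, ENNReal.ofReal (Real.exp (-|x| / b) / (2 * b)) =
      ∫⁻ x in Set.Iic t, ENNReal.ofReal (Real.exp ((1 / b) * x) / (2 * b)) := by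
    refine setLIntegral_congr_fun measurableSet_Iic fun x hx => ?_
    have : x ≤ 0 := le_trans hx ht
    simp only [abs_of_nonpos this]
    congr 3
    ring
  have hpos : 0 < 1 / b := by positivity
  rw [h1, ← ofReal_integral_eq_lintegral_ofReal]
  · rw [integral_div, integral_exp_mul_Iic hpos]
    congr 1
    rw [show 1 / b * t = t / b by ring]
    field_simp
  · exact (integrableOn_exp_mul_Iic hpos t).div_const _
  · exact Filter.Eventually.of_forall fun x => by positivity

theorem isProbabilityMeasure_laplace {b : ℝ} (hb : 0 < b) : IsProbabilityMeasure (laplace b) := by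
  constructor
  rw [← Set.Iic_union_Ioi (a := (0 : ℝ)), measure_union (by simp) measurableSet_Ioi,
    laplace_Iic hb le_rfl, laplace_Ioi hb le_rfl, ← ENNReal.ofReal_add (by positivity)
      (by positivity)]
  norm_num

instance : IsProbabilityMeasure (laplace 1) := isProbabilityMeasure_laplace one_pos

/-- Needed because the machine draws only Laplace numbers of scale 1. The two laws have the same
distribution function. -/
theorem laplace_eq_map {b : ℝ} (hb : 0 < b) : laplace b = (laplace 1).map fun x => b * x := by
  have := isProbabilityMeasure_laplace hb
  have hm : Measurable fun x : ℝ => b * x := by fun_prop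
  have := Measure.isProbabilityMeasure_map (μ := laplace 1) hm.aemeasurable
  refine Measure.ext_of_Iic _ _ fun t => ?_
  rw [Measure.map_apply hm measurableSet_Iic]
  have hpre : (fun x : ℝ => b * x) ⁻¹' Set.Iic t = Set.Iic (t / b) := by
    ext x; simp [le_div_iff₀ hb, mul_comm]
  rw [hpre]
  rcases le_total t 0 with ht | ht
  · rw [laplace_Iic hb ht, laplace_Iic one_pos (div_nonpos_of_nonpos_of_nonneg ht hb.le), div_one]
  · rw [← Set.compl_Ioi, ← Set.compl_Ioi, prob_compl_eq_one_sub measurableSet_Ioi,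
      prob_compl_eq_one_sub measurableSet_Ioi, laplace_Ioi hb ht,
      laplace_Ioi one_pos (div_nonneg ht hb.le), div_one, neg_div]

theorem laplace_preimage_add {b : ℝ} (x : ℝ) {A : Set ℝ} (hA : MeasurableSet A) :
    laplace b ((fun z => x + z) ⁻¹' A) =
      ∫⁻ y in A, ENNReal.ofReal (Real.exp (-|y - x| / b) / (2 * b)) := by
  have hm : Measurable fun z : ℝ => x + z := by fun_prop
  rw [laplace, withDensity_apply _ (hm hA), ← lintegral_indicator (hm hA),
    ← lintegral_indicator hA,
    ← lintegral_add_left_eq_self (A.indicator _) x]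
  refine lintegral_congr fun z => ?_
  by_cases hz : x + z ∈ A <;> simp [Set.indicator, hz]

/-- Moving the centre of Laplace noise by `r` changes probabilities by a factor of at most
`exp (r / b)`. -/
theorem laplace_preimage_add_le {b : ℝ} (hb : 0 < b) (x x' : ℝ) {A : Set ℝ}
    (hA : MeasurableSet A) :
    laplace b ((fun z => x + z) ⁻¹' A) ≤
      ENNReal.ofReal (Real.exp (|x - x'| / b)) * laplace b ((fun z => x' + z) ⁻¹' A) := by
  rw [laplace_preimage_add x hA, laplace_preimage_add x' hA, ← lintegral_const_mul' _ _ (by simp)]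
  refine lintegral_mono fun y => ?_
  rw [← ENNReal.ofReal_mul (by positivity)]
  refine ENNReal.ofReal_le_ofReal ?_
  rw [← mul_div_assoc, ← Real.exp_add]
  gcongr
  rw [← add_div]
  gcongr
  have := abs_sub_abs_le_abs_sub (y - x') (y - x)
  have h2 : |y - x' - (y - x)| = |x - x'| := by congr 1; ring
  linarith

/-! ### The law of the rounded noisy point -/

/-- The probability that a point `x` with Laplace noise of scale `b` is rounded to a word in `W`. -/
noncomputable def hitProb {d : ℕ} (b : ℝ) (W : Finset (Fin d → Bool)) (x : Fin d → ℝ) : ℝ≥0∞ :=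
  ∑ w ∈ W, ∏ i, laplace b ((fun z => x i + z) ⁻¹' {y | decide (1 / 2 ≤ y) = w i})

theorem measurableSet_decide_eq (c : Bool) :
    MeasurableSet {y : ℝ | decide (1 / 2 ≤ y) = c} := by
  cases c
  · have : {y : ℝ | decide (1 / 2 ≤ y) = false} = Set.Iio (1 / 2) := by ext; simp
    rw [this]; exact measurableSet_Iio
  · have : {y : ℝ | decide (1 / 2 ≤ y) = true} = Set.Ici (1 / 2) := by ext; simp
    rw [this]; exact measurableSet_Ici

theorem measurable_roundCube {d : ℕ} : Measurable (roundCube : (Fin d → ℝ) → Fin d → Bool) := by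
  refine measurable_pi_lambda _ fun i => ?_
  refine measurable_to_countable' fun c => ?_
  exact (measurableSet_decide_eq c).preimage (measurable_pi_apply i)

theorem pi_laplace_roundCube_mem {d : ℕ} {b : ℝ} (hb : 0 < b) (W : Finset (Fin d → Bool))
    (x : Fin d → ℝ) :
    Measure.pi (fun _ : Fin d => laplace b) ((fun y => roundCube (x + y)) ⁻¹' W) =
      hitProb b W x := by
  have := isProbabilityMeasure_laplace hb
  have hm : Measurable fun y : Fin d → ℝ => roundCube (x + y) :=
    measurable_roundCube.comp (measurable_const_add x)
  rw [← Measure.map_apply hm W.measurableSet, ← sum_measure_singleton, hitProb]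
  refine Finset.sum_congr rfl fun w _ => ?_
  rw [Measure.map_apply hm (measurableSet_singleton w), ← Measure.pi_pi]
  congr 1
  ext y
  simp [roundCube, funext_iff]

/-- The coordinates are independent, so the one-dimensional factors multiply and the exponents add
up to the ℓ₁ distance. -/
theorem hitProb_le {d : ℕ} {b : ℝ} (hb : 0 < b) (W : Finset (Fin d → Bool)) (x x' : Fin d → ℝ) :
    hitProb b W x ≤ ENNReal.ofReal (Real.exp ((∑ i, |x i - x' i|) / b)) * hitProb b W x' := by
  rw [hitProb, hitProb, Finset.mul_sum]
  refine Finset.sum_le_sum fun w _ => ?_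
  rw [Finset.sum_div, Real.exp_sum, ENNReal.ofReal_prod_of_nonneg fun i _ => (Real.exp_pos _).le,
    ← Finset.prod_mul_distrib]
  exact Finset.prod_le_prod' fun i _ =>
    laplace_preimage_add_le hb _ _ (measurableSet_decide_eq _)

theorem measurable_hitProb {d : ℕ} {b : ℝ} (hb : 0 < b) (W : Finset (Fin d → Bool)) :
    Measurable (hitProb b W) := by
  have := isProbabilityMeasure_laplace hb
  refine Finset.measurable_sum _ fun w _ => Finset.measurable_prod _ fun i _ => ?_
  have hs : MeasurableSet {p : ℝ × ℝ | p.1 + p.2 ∈ {y : ℝ | decide (1 / 2 ≤ y) = w i}} :=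
    (measurableSet_decide_eq (w i)).preimage (measurable_fst.add measurable_snd)
  exact (measurable_measure_prodMk_left (ν := laplace b) hs).comp (measurable_pi_apply i)

theorem hitProb_le_one {d : ℕ} {b : ℝ} (hb : 0 < b) (W : Finset (Fin d → Bool)) (x : Fin d → ℝ) :
    hitProb b W x ≤ 1 := by
  have := isProbabilityMeasure_laplace hb
  rw [← pi_laplace_roundCube_mem hb]
  exact prob_le_one

/-! ### The law of the purified output -/

theorem volume_unitCube (d : ℕ) : volume (Set.Icc (0 : Fin d → ℝ) 1) = 1 := by
  simp [Real.volume_Icc_pi]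

theorem cond_volume_unitCube (d : ℕ) :
    cond volume (Set.Icc (0 : Fin d → ℝ) 1) = volume.restrict (Set.Icc 0 1) := by
  simp [ProbabilityTheory.cond, volume_unitCube]

/-- The words that are decoded to an element of `S`. -/
noncomputable def decodeWords {N : ℕ} (bot : Fin N) (S : Set (Fin N)) :
    Finset (Fin (bits N) → Bool) := by
  classical exact Finset.univ.filter fun w => decode bot w ∈ S

/-- Integrating out the noise first turns the convolution into an average of `hitProb` over the law
of the point; this average splits along the mixture. -/
theorem purifyDiscrete_apply {N : ℕ} {ε δ b : ℝ} (bot : Fin N) (μ : Measure (Fin N))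
    [IsProbabilityMeasure μ] (hb : 0 < b)
    (hscale : 2 * purifyDelta (bits N) ∞ 1 δ ((2 : ℝ)⁻¹ ^ bits N) / ε = b) (S : Set (Fin N)) :
    purifyDiscrete ε δ bot μ S =
      ENNReal.ofReal (1 - (2 : ℝ)⁻¹ ^ bits N) *
        ∫⁻ u, hitProb b (decodeWords bot S) (binMap u) ∂μ +
      ENNReal.ofReal ((2 : ℝ)⁻¹ ^ bits N) *
        ∫⁻ x in Set.Icc 0 1, hitProb b (decodeWords bot S) x := by
  have := isProbabilityMeasure_laplace hb
  have hdec : Measurable (decode bot) := measurable_of_finite _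
  have hm : Measurable fun z : Fin (bits N) → ℝ => decode bot (roundCube z) :=
    hdec.comp measurable_roundCube
  have hS : MeasurableSet S := S.to_countable.measurableSet
  have hT := hm hS
  rw [purifyDiscrete, Measure.map_apply hm hS, purify, hscale, cond_volume_unitCube,
    ← lintegral_indicator_one hT, Measure.lintegral_conv (measurable_one.indicator hT)]
  have key : ∀ x : Fin (bits N) → ℝ,
      ∫⁻ y, ((fun z => decode bot (roundCube z)) ⁻¹' S).indicator (1 : (Fin (bits N) → ℝ) → ℝ≥0∞)
        (x + y) ∂(Measure.pi fun _ => laplace b) = hitProb b (decodeWords bot S) x := by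
    intro x
    have hx : Measurable fun y : Fin (bits N) → ℝ => x + y := by fun_prop
    rw [← pi_laplace_roundCube_mem hb]
    have hW : MeasurableSet
        ((fun y => roundCube (x + y)) ⁻¹' (decodeWords bot S : Set (Fin (bits N) → Bool))) :=
      (measurable_roundCube.comp hx) (Finset.measurableSet _)
    rw [← lintegral_indicator_one hW]
    refine lintegral_congr fun y => ?_
    have hiff : x + y ∈ (fun z => decode bot (roundCube z)) ⁻¹' S ↔
        y ∈ (fun y => roundCube (x + y)) ⁻¹' (decodeWords bot S : Set (Fin (bits N) → Bool)) := by
      simp [decodeWords]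
    by_cases h : x + y ∈ (fun z => decode bot (roundCube z)) ⁻¹' S
    · rw [Set.indicator_of_mem h, Set.indicator_of_mem (hiff.1 h)]; rfl
    · rw [Set.indicator_of_notMem h, Set.indicator_of_notMem (mt hiff.2 h)]
  simp only [key]
  have hbin : Measurable (binMap (N := N)) := measurable_of_finite _
  rw [lintegral_add_measure, lintegral_smul_measure, lintegral_smul_measure,
    lintegral_map (measurable_hitProb hb _) hbin]
  rfl

/-! ### The parameters of the algorithm -/

theorem bits_pos {N : ℕ} (hN : 2 ≤ N) : 0 < bits N := Nat.clog_pos one_lt_two hN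

/-- The scale `4 · 2^(-1/d) / d²` of the noise of the purification. -/
noncomputable def noiseScale (d : ℕ) : ℝ := 4 * (Real.exp (0 - Real.log 2 / d) / d / d)

theorem noiseScale_pos {d : ℕ} (hd : 0 < d) : 0 < noiseScale d := by
  have : (0 : ℝ) < d := by exact_mod_cast hd
  unfold noiseScale; positivity

/-- Here δ = (ε / (2d³))^d and 2ω = 2 · 2^(-d), so the quotient is (ε / d³)^d / 2, and the d-th root
leaves the factor 2^(-1/d). No assumption δ ≤ 1 is needed. -/
theorem rpow_exp_neg_logInvDelta {N : ℕ} (hN : 2 ≤ N) {ε : ℝ} (hε : 0 < ε) :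
    (Real.exp (-logInvDelta N ε) / (2 * (2 : ℝ)⁻¹ ^ bits N)) ^ (1 / (bits N : ℝ)) =
      ε / (bits N : ℝ) ^ 3 * Real.exp (0 - Real.log 2 / bits N) := by
  have hd : (0 : ℝ) < bits N := by exact_mod_cast bits_pos hN
  have h1 : Real.exp (-logInvDelta N ε) / (2 * (2 : ℝ)⁻¹ ^ bits N) =
      (ε / (bits N : ℝ) ^ 3) ^ bits N / 2 := by
    have : Real.exp (-logInvDelta N ε) = (ε / (2 * (bits N : ℝ) ^ 3)) ^ bits N := by
      rw [logInvDelta, ← mul_neg, ← Real.log_inv, mul_comm, ← Real.rpow_def_of_pos (by positivity),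
        Real.rpow_natCast, inv_div]
    rw [this, mul_comm (2 : ℝ) ((bits N : ℝ) ^ 3), ← div_div ε, div_pow _ (2 : ℝ), inv_pow]
    field_simp
  rw [h1, Real.div_rpow (by positivity) (by norm_num), one_div,
    Real.pow_rpow_inv_natCast (by positivity) (bits_pos hN).ne', div_eq_mul_inv _ ((2 : ℝ) ^ _),
    ← Real.rpow_neg (by norm_num), Real.rpow_def_of_pos (by norm_num : (0 : ℝ) < 2)]
  congr 2
  ring

/-- The factor ε in δ^(1/d) cancels the division by ε, so the noise scale depends on d only. The
unsimplified shape of `noiseScale` is the expression that the program evaluates. -/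
theorem two_mul_purifyDelta_div {N : ℕ} (hN : 2 ≤ N) {ε : ℝ} (hε : 0 < ε) :
    2 * purifyDelta (bits N) ∞ 1 (Real.exp (-logInvDelta N ε)) ((2 : ℝ)⁻¹ ^ bits N) / ε =
      noiseScale (bits N) := by
  have hd : (0 : ℝ) < bits N := by exact_mod_cast bits_pos hN
  rw [purifyDelta, rpow_exp_neg_logInvDelta hN hε, noiseScale]
  simp only [ENNReal.div_top, ENNReal.toReal_zero, sub_zero, Real.rpow_one]
  field_simp
  ring

/-! ### The law of the output -/

/-- The noises for which the distance-to-instability test succeeds. -/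
def passSet {n N : ℕ} [NeZero N] (ε : ℝ) (D : Fin n → Fin N) : Set ℝ :=
  {z | ¬ ((instabilityDist D : ℝ) - 1 + z ≤ logInvDelta N ε / ε)}

theorem passSet_eq {n N : ℕ} [NeZero N] (ε : ℝ) (D : Fin n → Fin N) :
    passSet ε D = Set.Ioi (logInvDelta N ε / ε - ((instabilityDist D : ℝ) - 1)) := by
  ext z
  simp only [passSet, not_le, Set.mem_ofPred_eq, Set.mem_Ioi]
  constructor <;> intro h <;> linarith

theorem measurableSet_passSet {n N : ℕ} [NeZero N] (ε : ℝ) (D : Fin n → Fin N) :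
    MeasurableSet (passSet ε D) :=
  passSet_eq ε D ▸ measurableSet_Ioi

theorem measurable_test {n N : ℕ} [NeZero N] (ε : ℝ) (bot : Fin N) (D : Fin n → Fin N) :
    Measurable fun z : ℝ =>
      if (instabilityDist D : ℝ) - 1 + z ≤ logInvDelta N ε / ε then bot else mode D :=
  Measurable.ite (measurableSet_le (by fun_prop) (by fun_prop)) measurable_const measurable_const

theorem isProbabilityMeasure_approxMode {n N : ℕ} [NeZero N] {ε : ℝ} (hε : 0 < ε) (bot : Fin N)
    (D : Fin n → Fin N) : IsProbabilityMeasure (approxMode ε bot D) := by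
  have := isProbabilityMeasure_laplace (b := 1 / ε) (by positivity)
  exact Measure.isProbabilityMeasure_map (measurable_test ε bot D).aemeasurable

theorem lintegral_approxMode {n N : ℕ} [NeZero N] (ε : ℝ) (bot : Fin N)
    (D : Fin n → Fin N) (g : Fin N → ℝ≥0∞) :
    ∫⁻ u, g u ∂approxMode ε bot D =
      laplace (1 / ε) (passSet ε D) * g (mode D) + laplace (1 / ε) (passSet ε D)ᶜ * g bot := by
  rw [approxMode, lintegral_map (measurable_of_finite g) (measurable_test ε bot D),
    ← lintegral_add_compl _ (measurableSet_passSet ε D)]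
  congr 1
  · rw [mul_comm, ← setLIntegral_const]
    refine setLIntegral_congr_fun (measurableSet_passSet ε D) fun z hz => ?_
    simp only [passSet, Set.mem_ofPred_eq] at hz
    simp [hz]
  · rw [mul_comm, ← setLIntegral_const]
    refine setLIntegral_congr_fun (measurableSet_passSet ε D).compl fun z hz => ?_
    simp only [passSet, Set.mem_compl_iff, Set.mem_ofPred_eq, not_not] at hz
    simp [hz]

/-- Both privacy and utility are read off from this formula; only the pass probability and the
position of the mode depend on the dataset. -/
theorem modeRelease_apply {n N : ℕ} [NeZero N] (hN : 2 ≤ N) {ε : ℝ} (hε : 0 < ε) (bot : Fin N)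
    (D : Fin n → Fin N) (S : Set (Fin N)) :
    modeRelease ε bot D S =
      ENNReal.ofReal (1 - (2 : ℝ)⁻¹ ^ bits N) *
        (laplace (1 / ε) (passSet ε D) *
            hitProb (noiseScale (bits N)) (decodeWords bot S) (binMap (mode D)) +
          laplace (1 / ε) (passSet ε D)ᶜ *
            hitProb (noiseScale (bits N)) (decodeWords bot S) (binMap bot)) +
      ENNReal.ofReal ((2 : ℝ)⁻¹ ^ bits N) *
        ∫⁻ x in Set.Icc 0 1, hitProb (noiseScale (bits N)) (decodeWords bot S) x := by
  have := isProbabilityMeasure_approxMode hε bot D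
  rw [modeRelease, purifyDiscrete_apply bot _ (noiseScale_pos (bits_pos hN))
    (two_mul_purifyDelta_div hN hε), lintegral_approxMode]

theorem isProbabilityMeasure_modeRelease {n N : ℕ} [NeZero N] (hN : 2 ≤ N) {ε : ℝ} (hε : 0 < ε)
    (bot : Fin N) (D : Fin n → Fin N) : IsProbabilityMeasure (modeRelease ε bot D) := by
  have := isProbabilityMeasure_laplace (b := 1 / ε) (by positivity)
  have hb := noiseScale_pos (bits_pos hN)
  have := isProbabilityMeasure_laplace hb
  constructor
  rw [modeRelease_apply hN hε]
  have h1 : ∀ x, hitProb (noiseScale (bits N)) (decodeWords bot Set.univ) x = 1 := by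
    intro x
    rw [← pi_laplace_roundCube_mem hb]
    simp [decodeWords]
  have hω : (2 : ℝ)⁻¹ ^ bits N ≤ 1 := pow_le_one₀ (by norm_num) (by norm_num)
  simp only [h1, mul_one]
  rw [prob_add_prob_compl (measurableSet_passSet ε D)]
  simp only [lintegral_const, Measure.restrict_apply_univ, volume_unitCube, mul_one]
  rw [← ENNReal.ofReal_add (by linarith) (by positivity)]
  simp

/-! ### Sensitivity of the mode -/

section Sensitivity

variable {n N : ℕ} {D D' : Fin n → Fin N}

theorem freq_le_freq_add_one (h : hammingDist D D' ≤ 1) (x : Fin N) :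
    freq D x ≤ freq D' x + 1 := by
  unfold freq
  refine le_trans ?_ (Nat.add_le_add_left h _)
  refine le_trans (Finset.card_le_card ?_) (Finset.card_union_le _ _)
  intro i hi
  by_cases hD : D i = D' i <;> simp_all

variable [NeZero N]

theorem freq_le_freq_mode (D : Fin n → Fin N) (x : Fin N) : freq D x ≤ freq D (mode D) := by
  have h := Finset.min'_mem (modes D) (modes_nonempty D)
  simp only [modes, Finset.mem_filter, Finset.mem_univ, true_and] at h
  exact h x

theorem freq_le_occ₂ {x : Fin N} (hx : x ≠ mode D) : freq D x ≤ occ₂ D :=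
  Finset.le_sup (f := freq D) (by simp [hx])

theorem occ₂_le_occ₁ (D : Fin n → Fin N) : occ₂ D ≤ occ₁ D :=
  Finset.sup_le fun x _ => freq_le_freq_mode D x

/-- Going from D to D' and back loses one occurrence each way: the mode of D beats that of D' by at
most 2 in D, and the latter is a competitor counted in `occ₂ D`. -/
theorem instabilityDist_le_one_of_mode_ne (h : hammingDist D D' ≤ 1) (hne : mode D ≠ mode D') :
    instabilityDist D ≤ 1 := by
  have h1 := freq_le_freq_add_one h (mode D)
  have h2 := freq_le_freq_mode D' (mode D)
  have h3 := freq_le_freq_add_one ((hammingDist_comm D' D).trans_le h) (mode D')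
  have h4 := freq_le_occ₂ hne.symm
  have h5 : occ₁ D ≤ occ₂ D + 2 := by unfold occ₁; omega
  have h6 : (occ₁ D : ℝ) ≤ occ₂ D + 2 := by exact_mod_cast h5
  rw [instabilityDist, Int.ceil_le]
  push_cast
  linarith

/-- One changed entry raises `occ₁` by at most 1 and lowers `occ₂` by at most 1. With the same mode,
`occ₂` is a maximum over the same items, and halving turns the change 2 into 1. -/
theorem instabilityDist_le_add_one_of_mode_eq (h : hammingDist D D' ≤ 1)
    (heq : mode D = mode D') : instabilityDist D ≤ instabilityDist D' + 1 := by
  have h1 : (occ₁ D : ℝ) ≤ occ₁ D' + 1 := by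
    have := freq_le_freq_add_one h (mode D)
    have h' : occ₁ D ≤ occ₁ D' + 1 := by unfold occ₁; rwa [← heq]
    exact_mod_cast h'
  have h2 : (occ₂ D' : ℝ) ≤ occ₂ D + 1 := by
    have : occ₂ D' ≤ occ₂ D + 1 := by
      refine Finset.sup_le fun x hx => ?_
      have hx' : x ≠ mode D := by rw [heq]; exact Finset.ne_of_mem_erase hx
      have := freq_le_freq_add_one ((hammingDist_comm D' D).trans_le h) x
      have := freq_le_occ₂ hx'
      omega
    exact_mod_cast this
  rw [instabilityDist, Int.ceil_le]
  push_cast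
  have h3 := Int.le_ceil (((occ₁ D' : ℝ) - occ₂ D') / 2)
  unfold instabilityDist
  linarith

/-- The test is `ε`-differentially private as long as the mode does not change. -/
theorem laplace_passSet_le {ε : ℝ} (hε : 0 < ε) (h : hammingDist D D' ≤ 1)
    (heq : mode D = mode D') :
    laplace (1 / ε) (passSet ε D) ≤ ENNReal.ofReal (Real.exp ε) * laplace (1 / ε) (passSet ε D') ∧
      laplace (1 / ε) (passSet ε D)ᶜ ≤
        ENNReal.ofReal (Real.exp ε) * laplace (1 / ε) (passSet ε D')ᶜ := by
  have hb : 0 < 1 / ε := by positivity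
  have h1 := instabilityDist_le_add_one_of_mode_eq h heq
  have h2 := instabilityDist_le_add_one_of_mode_eq ((hammingDist_comm D' D).trans_le h) heq.symm
  have h3 : |((instabilityDist D : ℝ) - 1) - ((instabilityDist D' : ℝ) - 1)| / (1 / ε) ≤ ε := by
    have : |((instabilityDist D : ℝ) - 1) - ((instabilityDist D' : ℝ) - 1)| ≤ 1 := by
      have h1' : (instabilityDist D : ℝ) ≤ instabilityDist D' + 1 := by exact_mod_cast h1
      have h2' : (instabilityDist D' : ℝ) ≤ instabilityDist D + 1 := by exact_mod_cast h2
      rw [abs_le]; constructor <;> linarith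
    rw [div_le_iff₀ hb, mul_one_div_cancel hε.ne']
    exact this
  have key : ∀ A : Set ℝ, MeasurableSet A →
      laplace (1 / ε) ((fun z => ((instabilityDist D : ℝ) - 1) + z) ⁻¹' A) ≤
        ENNReal.ofReal (Real.exp ε) *
          laplace (1 / ε) ((fun z => ((instabilityDist D' : ℝ) - 1) + z) ⁻¹' A) := fun A hA =>
    (laplace_preimage_add_le hb _ ((instabilityDist D' : ℝ) - 1) hA).trans <| by gcongr
  exact ⟨key _ (measurableSet_Iic (a := logInvDelta N ε / ε)).compl,
    by simpa [passSet_eq] using key _ (measurableSet_Iic (a := logInvDelta N ε / ε))⟩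

/-- Passing now requires noise above log(1/δ)/ε, whose Laplace tail is δ/2. The condition δ ≤ 1
places the threshold on the side where this tail formula is valid. -/
theorem laplace_passSet_le_of_instabilityDist_le_one {ε : ℝ} (hε : 0 < ε)
    (h : instabilityDist D ≤ 1) (hδ : 0 ≤ logInvDelta N ε) :
    laplace (1 / ε) (passSet ε D) ≤ ENNReal.ofReal (Real.exp (-logInvDelta N ε) / 2) := by
  have h' : (instabilityDist D : ℝ) ≤ 1 := by exact_mod_cast h
  have hsub : passSet ε D ⊆ Set.Ioi (logInvDelta N ε / ε) := by
    rw [passSet_eq]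
    exact Set.Ioi_subset_Ioi (by linarith)
  refine (measure_mono hsub).trans_eq ?_
  rw [laplace_Ioi (by positivity) (by positivity)]
  congr 3
  field_simp

end Sensitivity

/-! ### Transport of a small mass along a chain of cubes -/

section Chain

variable {d : ℕ}

/-- The `j`-th of `k` cubes of side `1 / k` that lead from the vertex `m` of the unit cube to the
vertex `v`. -/
def chainCube (k : ℕ) (m v : Fin d → Bool) (j : ℕ) : Set (Fin d → ℝ) :=
  Set.univ.pi fun i =>
    Set.Ico ((m i).toNat * (1 - 1 / k : ℝ) + j / k * ((v i).toNat - (m i).toNat : ℝ))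
      ((m i).toNat * (1 - 1 / k : ℝ) + j / k * ((v i).toNat - (m i).toNat : ℝ) + 1 / k)

variable {k : ℕ} {m v : Fin d → Bool}

theorem measurableSet_chainCube (j : ℕ) : MeasurableSet (chainCube k m v j) :=
  MeasurableSet.univ_pi fun _ => measurableSet_Ico

theorem volume_chainCube (j : ℕ) :
    volume (chainCube k m v j) = ENNReal.ofReal ((1 / k : ℝ) ^ d) := by
  rw [chainCube, Real.volume_pi_Ico, ENNReal.ofReal_pow (by positivity)]
  simp

theorem chainCube_subset {j : ℕ} (hj : j < k) : chainCube k m v j ⊆ Set.Icc 0 1 := by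
  have hk : (0 : ℝ) < k := by exact_mod_cast (Nat.zero_le j).trans_lt hj
  have hj' : ((j : ℝ) + 1) / k ≤ 1 := by
    rw [div_le_one hk]; exact_mod_cast hj
  have h0 : (0 : ℝ) ≤ j / k := by positivity
  have h1 : (0 : ℝ) < 1 / k := by positivity
  rw [add_div] at hj'
  intro x hx
  rw [Set.mem_Icc, Pi.le_def, Pi.le_def]
  constructor <;> intro i <;> have hi := hx i (Set.mem_univ i) <;>
    cases hm : m i <;> cases hv : v i <;>
    simp only [hm, hv, Bool.toNat_false, Bool.toNat_true, Nat.cast_zero, Nat.cast_one, Set.mem_Ico,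
      Pi.zero_apply, Pi.one_apply] at hi ⊢ <;> linarith [hi.1, hi.2]

/-- In a coordinate where the vertices differ, different indices give disjoint half-open intervals.
-/
theorem disjoint_chainCube (hne : m ≠ v) {j l : ℕ} (hk : 0 < k) (hjl : j ≠ l) :
    Disjoint (chainCube k m v j) (chainCube k m v l) := by
  wlog hlt : j < l generalizing j l
  · exact (this hjl.symm (by omega)).symm
  obtain ⟨i, hi⟩ := Function.ne_iff.1 hne
  have hk' : (0 : ℝ) < k := by exact_mod_cast hk
  have hstep : (j : ℝ) / k + 1 / k ≤ l / k := by
    rw [← add_div]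
    have : (j : ℝ) + 1 ≤ l := by exact_mod_cast hlt
    gcongr
  rw [Set.disjoint_left]
  intro x hx hx'
  have h1 := hx i (Set.mem_univ i)
  have h2 := hx' i (Set.mem_univ i)
  cases hm : m i <;> cases hv : v i <;> simp only [hm, hv] at hi h1 h2 <;>
    simp only [Bool.toNat_false, Bool.toNat_true, Nat.cast_zero, Nat.cast_one, Set.mem_Ico,
      ne_eq, not_true_eq_false] at hi h1 h2 <;> linarith [h1.1, h1.2, h2.1, h2.2]

theorem preimage_chainCube_succ (j : ℕ) :
    (fun x : Fin d → ℝ => x + fun i => 1 / k * ((v i).toNat - (m i).toNat : ℝ)) ⁻¹'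
      chainCube k m v (j + 1) = chainCube k m v j := by
  ext x
  simp only [chainCube, Set.mem_preimage, Set.mem_univ_pi, Set.mem_Ico, Pi.add_apply]
  refine forall_congr' fun i => ?_
  push_cast
  rw [add_div, add_mul]
  constructor <;> rintro ⟨h1, h2⟩ <;> constructor <;> linarith

theorem abs_toNat_sub_toNat_le (a c : Bool) : |(a.toNat - c.toNat : ℝ)| ≤ 1 := by
  cases a <;> cases c <;> simp

theorem sum_abs_div_le {b c : ℝ} (hb : 0 < b) {y : Fin d → ℝ} (hy : ∀ i, |y i| ≤ c) :
    (∑ i, |y i|) / b ≤ d * c / b := by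
  gcongr
  calc ∑ i, |y i| ≤ ∑ _i : Fin d, c := Finset.sum_le_sum fun i _ => hy i
    _ = d * c := by simp

variable {b : ℝ} {h : (Fin d → ℝ) → ℝ≥0∞}

theorem le_of_abs_sub_le (hb : 0 < b)
    (hlip : ∀ x x', h x ≤ ENNReal.ofReal (Real.exp ((∑ i, |x i - x' i|) / b)) * h x')
    {c : ℝ} {x x' : Fin d → ℝ} (hxx : ∀ i, |x i - x' i| ≤ c) :
    h x ≤ ENNReal.ofReal (Real.exp (d * c / b)) * h x' :=
  (hlip x x').trans <| by
    gcongr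
    exact (div_le_div_iff_of_pos_right hb).1 (sum_abs_div_le hb hxx)

theorem setLIntegral_chainCube_le_succ (hb : 0 < b)
    (hlip : ∀ x x', h x ≤ ENNReal.ofReal (Real.exp ((∑ i, |x i - x' i|) / b)) * h x') (j : ℕ) :
    ∫⁻ x in chainCube k m v j, h x ≤
      ENNReal.ofReal (Real.exp (d * (1 / k) / b)) * ∫⁻ x in chainCube k m v (j + 1), h x := by
  set u : Fin d → ℝ := fun i => 1 / k * ((v i).toNat - (m i).toNat : ℝ) with hu
  have hshift : ∫⁻ x in chainCube k m v (j + 1), h x = ∫⁻ x in chainCube k m v j, h (x + u) := by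
    rw [← lintegral_indicator (measurableSet_chainCube _),
      ← lintegral_indicator (measurableSet_chainCube _),
      ← lintegral_add_right_eq_self _ u]
    refine lintegral_congr fun x => ?_
    have hiff : x + u ∈ chainCube k m v (j + 1) ↔ x ∈ chainCube k m v j := by
      rw [← preimage_chainCube_succ j]; rfl
    by_cases hx : x ∈ chainCube k m v j
    · rw [Set.indicator_of_mem hx, Set.indicator_of_mem (hiff.2 hx)]
    · rw [Set.indicator_of_notMem hx, Set.indicator_of_notMem (mt hiff.1 hx)]
  rw [hshift, ← lintegral_const_mul' _ _ (by simp)]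
  refine lintegral_mono fun x => le_of_abs_sub_le hb hlip fun i => ?_
  have hk : (0 : ℝ) ≤ 1 / k := by positivity
  simp only [Pi.add_apply, hu, sub_add_cancel_left, abs_neg, abs_mul, abs_of_nonneg hk]
  exact mul_le_of_le_one_right hk (abs_toNat_sub_toNat_le _ _)

/-- If `log h` is Lipschitz, then a mass `p` that does not exceed the mass `ω / k ^ d` of a cube of
side `1 / k` can be moved from one vertex of the unit cube to another at the cost of a factor that
is determined by the side of the cube only. -/
theorem mul_add_lintegral_le (hb : 0 < b)
    (hlip : ∀ x x', h x ≤ ENNReal.ofReal (Real.exp ((∑ i, |x i - x' i|) / b)) * h x')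
    (hk : 0 < k) {p ω : ℝ≥0∞} (hp : p ≤ ω * ENNReal.ofReal ((1 / k : ℝ) ^ d)) :
    p * h (fun i => (m i).toNat) + ω * ∫⁻ x in Set.Icc 0 1, h x ≤
      ENNReal.ofReal (Real.exp (d * (1 / k) / b)) *
        (p * h (fun i => (v i).toNat) + ω * ∫⁻ x in Set.Icc 0 1, h x) := by
  set L := ENNReal.ofReal (Real.exp (d * (1 / k) / b)) with hL
  have hk' : (0 : ℝ) < k := by exact_mod_cast hk
  have hL1 : 1 ≤ L := by
    rw [hL, ENNReal.one_le_ofReal, Real.one_le_exp_iff]; positivity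
  -- For equal vertices all the cubes of the chain coincide, so this case is separate.
  by_cases hne : m = v
  · subst hne
    exact le_mul_of_one_le_left' hL1
  set V := ENNReal.ofReal ((1 / k : ℝ) ^ d) with hV
  have hV0 : V ≠ 0 := by rw [hV, ne_eq, ENNReal.ofReal_eq_zero, not_le]; positivity
  have hVt : V ≠ ∞ := ENNReal.ofReal_ne_top
  set A : ℕ → ℝ≥0∞ := fun j => ∫⁻ x in chainCube k m v j, h x with hA
  have hstart : V * h (fun i => (m i).toNat) ≤ L * A 0 := by
    rw [hA, ← lintegral_const_mul' _ _ ENNReal.ofReal_ne_top, hV,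
      ← volume_chainCube (m := m) (v := v) 0, mul_comm, ← setLIntegral_const]
    refine setLIntegral_mono' (measurableSet_chainCube 0) fun x hx =>
      le_of_abs_sub_le hb hlip fun i => ?_
    have hi := hx i (Set.mem_univ i)
    rw [abs_le]
    cases hm : m i <;> simp only [hm, Bool.toNat_false, Bool.toNat_true, Nat.cast_zero, Nat.cast_one,
      Set.mem_Ico, zero_div, zero_mul] at hi ⊢ <;> constructor <;> linarith [hi.1, hi.2]
  obtain ⟨l, rfl⟩ : ∃ l, k = l + 1 := ⟨k - 1, by omega⟩
  -- The last cube, with index k - 1, has the target vertex in its closure, so each of its points is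
  -- within 1/k of that vertex in every coordinate.
  have hend : A l ≤ L * (V * h (fun i => (v i).toNat)) := by
    rw [hA, hV, ← volume_chainCube (m := m) (v := v) l, ← mul_assoc, mul_comm L, mul_assoc,
      mul_comm, ← setLIntegral_const]
    refine setLIntegral_mono' (measurableSet_chainCube l) fun x hx =>
      le_of_abs_sub_le hb hlip fun i => ?_
    have hi := hx i (Set.mem_univ i)
    have hl : (l : ℝ) / ((l + 1 : ℕ) : ℝ) = 1 - 1 / ((l + 1 : ℕ) : ℝ) := by
      push_cast; field_simp; ring
    rw [hl] at hi
    rw [abs_le]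
    cases hm : m i <;> cases hv : v i <;> simp only [hm, hv, Bool.toNat_false, Bool.toNat_true, Nat.cast_zero,
      Nat.cast_one, Set.mem_Ico] at hi ⊢ <;> constructor <;> linarith [hi.1, hi.2]
  -- The relay: vertex to cube 0, cube j to cube j + 1, last cube to vertex. Every term is used
  -- once, hence one factor L instead of a power of it.
  have htel : V * h (fun i => (m i).toNat) + ∑ j ∈ Finset.range (l + 1), A j ≤
      L * (V * h (fun i => (v i).toNat) + ∑ j ∈ Finset.range (l + 1), A j) := by
    calc V * h (fun i => (m i).toNat) + ∑ j ∈ Finset.range (l + 1), A j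
        = V * h (fun i => (m i).toNat) + (∑ j ∈ Finset.range l, A j + A l) := by
          rw [Finset.sum_range_succ]
      _ ≤ L * A 0 + (∑ j ∈ Finset.range l, L * A (j + 1) +
            L * (V * h (fun i => (v i).toNat))) :=
          add_le_add hstart (add_le_add
            (Finset.sum_le_sum fun j _ => setLIntegral_chainCube_le_succ hb hlip j) hend)
      _ = L * (V * h (fun i => (v i).toNat) + ∑ j ∈ Finset.range (l + 1), A j) := by
          rw [Finset.sum_range_succ', ← Finset.mul_sum]; ring
  set U : Set (Fin d → ℝ) := ⋃ j ∈ Finset.range (l + 1), chainCube (l + 1) m v j with hU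
  have hUm : MeasurableSet U :=
    Finset.measurableSet_biUnion _ fun j _ => measurableSet_chainCube j
  have hUsub : U ⊆ Set.Icc 0 1 :=
    Set.iUnion₂_subset fun j hj => chainCube_subset (Finset.mem_range.1 hj)
  have hsplit : ∫⁻ x in Set.Icc 0 1, h x =
      ∑ j ∈ Finset.range (l + 1), A j + ∫⁻ x in Set.Icc 0 1 \ U, h x := by
    rw [hA, ← lintegral_biUnion_finset (fun i _ j _ hij => disjoint_chainCube hne hk hij)
      fun j _ => measurableSet_chainCube j, ← hU]
    rw [← lintegral_inter_add_sdiff h (Set.Icc 0 1) hUm, Set.inter_eq_self_of_subset_right hUsub]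
  set R := ∫⁻ x in Set.Icc 0 1 \ U, h x
  set B := ∑ j ∈ Finset.range (l + 1), A j
  -- Only the share θ = p / V of the uniform weight takes part in the relay; the remaining weight η,
  -- and everything outside the chain, stays in place.
  have hθ : p / V ≤ ω := ENNReal.div_le_of_le_mul hp
  obtain ⟨η, hη⟩ := exists_add_of_le hθ
  have hpV : p = p / V * V := (ENNReal.div_mul_cancel hV0 hVt).symm
  rw [hsplit]
  generalize p / V = θ at hη hpV
  subst hη hpV
  calc θ * V * h (fun i => (m i).toNat) + (θ + η) * (B + R)
      = θ * (V * h (fun i => (m i).toNat) + B) + (η * B + (θ + η) * R) := by ring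
    _ ≤ θ * (L * (V * h (fun i => (v i).toNat) + B)) + L * (η * B + (θ + η) * R) :=
        add_le_add (mul_le_mul_right htel _) (le_mul_of_one_le_left' hL1)
    _ = L * (θ * V * h (fun i => (v i).toNat) + (θ + η) * (B + R)) := by ring

end Chain

/-! ### Privacy -/

theorem binMap_eq {N : ℕ} (u : Fin N) :
    binMap u = fun i : Fin (bits N) => (((u : ℕ).testBit i).toNat : ℝ) := by
  ext i
  cases h : (u : ℕ).testBit i <;> simp [binMap, h]

/-- The side `(δ / (2ω))^(1/d)` of a cube whose mass under the uniform part of the mixture is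
`δ / 2`. -/
noncomputable def cubeSide (N : ℕ) (ε : ℝ) : ℝ :=
  ε / (bits N : ℝ) ^ 3 * Real.exp (0 - Real.log 2 / bits N)

section CubeSide

variable {N : ℕ} (hN : 2 ≤ N) {ε : ℝ} (hε : 0 < ε)

include hN hε

theorem cubeSide_pos : 0 < cubeSide N ε := by
  have hd : (0 : ℝ) < bits N := by exact_mod_cast bits_pos hN
  unfold cubeSide; positivity

/-- The price of a move by one cube side in every coordinate; the choice of the noise scale makes it
independent of N. -/
theorem bits_mul_cubeSide_div_noiseScale :
    bits N * cubeSide N ε / noiseScale (bits N) = ε / 4 := by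
  have hd : (0 : ℝ) < bits N := by exact_mod_cast bits_pos hN
  have := Real.exp_pos (0 - Real.log 2 / bits N)
  rw [cubeSide, noiseScale]
  field_simp

theorem mul_cubeSide_pow :
    (2 : ℝ)⁻¹ ^ bits N * cubeSide N ε ^ bits N = Real.exp (-logInvDelta N ε) / 2 := by
  rw [cubeSide, ← rpow_exp_neg_logInvDelta hN hε, one_div,
    Real.rpow_inv_natCast_pow (by positivity) (bits_pos hN).ne']
  field_simp

/-- From δ/2 = ω r^d ≤ ω ≤ 1/2. For large ε the formula may give δ > 1, but then r > 1 as well, and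
that case is treated without the chain. -/
theorem logInvDelta_nonneg_of_cubeSide_le_one (h : cubeSide N ε ≤ 1) : 0 ≤ logInvDelta N ε := by
  have h1 := mul_cubeSide_pow hN hε
  have h2 : cubeSide N ε ^ bits N ≤ 1 := pow_le_one₀ (cubeSide_pos hN hε).le h
  have h3 : (2 : ℝ)⁻¹ ^ bits N ≤ 2⁻¹ :=
    pow_le_of_le_one (by norm_num) (by norm_num) (bits_pos hN).ne'
  have h4 : (2 : ℝ)⁻¹ ^ bits N * cubeSide N ε ^ bits N ≤ 2⁻¹ * 1 := by
    have := (cubeSide_pos hN hε).le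
    gcongr
  have h5 : Real.exp (-logInvDelta N ε) ≤ 1 := by linarith
  have := Real.exp_le_one_iff.1 h5
  linarith

end CubeSide

theorem exists_nat_one_div_mem {r : ℝ} (hr : 0 < r) (hr1 : r ≤ 1) :
    ∃ k : ℕ, 0 < k ∧ r ≤ 1 / k ∧ (1 : ℝ) / k ≤ 2 * r := by
  have h1 : 1 ≤ 1 / r := by rwa [le_div_iff₀ hr, one_mul]
  have hk : 0 < ⌊1 / r⌋₊ := Nat.floor_pos.2 h1
  have hk' : (0 : ℝ) < ⌊1 / r⌋₊ := by exact_mod_cast hk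
  have hk1 : (1 : ℝ) ≤ ⌊1 / r⌋₊ := by exact_mod_cast hk
  -- The upper bound holds because 1/r < k + 1 ≤ 2k.
  refine ⟨⌊1 / r⌋₊, hk, ?_, ?_⟩
  · rw [le_div_iff₀ hk', mul_comm, ← le_div_iff₀ hr]
    exact Nat.floor_le (by positivity)
  · rw [div_le_iff₀ hk']
    have h2 := Nat.lt_floor_add_one (1 / r)
    rw [div_lt_iff₀ hr] at h2
    nlinarith

theorem hitProb_lipschitz_const {d : ℕ} {b : ℝ} (hb : 0 < b) (W : Finset (Fin d → Bool))
    {x x' : Fin d → ℝ} (hx : x ∈ Set.Icc 0 1) (hx' : x' ∈ Set.Icc 0 1) :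
    hitProb b W x ≤ ENNReal.ofReal (Real.exp (d / b)) * hitProb b W x' := by
  have := le_of_abs_sub_le (c := 1) hb (hitProb_le hb W) (x := x) (x' := x') fun i => by
    have h1 := hx.1 i
    have h2 := hx.2 i
    have h3 := hx'.1 i
    have h4 := hx'.2 i
    simp only [Pi.zero_apply, Pi.one_apply] at h1 h2 h3 h4
    rw [abs_le]; constructor <;> linarith
  simpa using this

theorem binMap_mem_Icc {N : ℕ} (u : Fin N) : binMap u ∈ Set.Icc (0 : Fin (bits N) → ℝ) 1 := by
  rw [binMap_eq]
  constructor <;> intro i <;> simp [Bool.toNat_le]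

theorem ofReal_mixture (d : ℕ) :
    ENNReal.ofReal (1 - (2 : ℝ)⁻¹ ^ d) + ENNReal.ofReal ((2 : ℝ)⁻¹ ^ d) = 1 := by
  have : (2 : ℝ)⁻¹ ^ d ≤ 1 := pow_le_one₀ (by norm_num) (by norm_num)
  rw [← ENNReal.ofReal_add (by linarith) (by positivity)]
  simp

section Privacy

variable {n N : ℕ} [NeZero N] {D D' : Fin n → Fin N} {ε : ℝ}

theorem modeRelease_le_of_mode_eq (hN : 2 ≤ N) (hε : 0 < ε) (bot : Fin N)
    (h : hammingDist D D' ≤ 1) (heq : mode D = mode D') (S : Set (Fin N)) :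
    modeRelease ε bot D S ≤ ENNReal.ofReal (Real.exp ε) * modeRelease ε bot D' S := by
  obtain ⟨h1, h2⟩ := laplace_passSet_le hε h heq
  have hE : 1 ≤ ENNReal.ofReal (Real.exp ε) := by
    rw [ENNReal.one_le_ofReal, Real.one_le_exp_iff]; exact hε.le
  rw [modeRelease_apply hN hε, modeRelease_apply hN hε, heq,
    mul_add (ENNReal.ofReal (Real.exp ε))]
  refine add_le_add ?_ (le_mul_of_one_le_left' hE)
  rw [mul_left_comm]
  gcongr
  rw [mul_add, ← mul_assoc, ← mul_assoc]
  gcongr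

/-- When the uniform part of the mixture cannot absorb `δ`, the noise alone hides everything. -/
theorem modeRelease_le_of_one_lt_cubeSide (hN : 2 ≤ N) (hε : 0 < ε) (bot : Fin N)
    (hr : 1 < cubeSide N ε) (S : Set (Fin N)) :
    modeRelease ε bot D S ≤ ENNReal.ofReal (Real.exp ε) * modeRelease ε bot D' S := by
  have := isProbabilityMeasure_laplace (b := 1 / ε) (by positivity)
  have hb := noiseScale_pos (bits_pos hN)
  have hd : (0 : ℝ) < bits N := by exact_mod_cast bits_pos hN
  set W := decodeWords bot S
  set L := ENNReal.ofReal (Real.exp (bits N / noiseScale (bits N))) with hL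
  -- Crossing the whole cube costs d / b ≤ d r / b = ε/4. It is paid twice, since both laws are
  -- compared with the value c at bot.
  have hLL : L * L ≤ ENNReal.ofReal (Real.exp ε) := by
    rw [hL, ← ENNReal.ofReal_mul (by positivity), ← Real.exp_add]
    gcongr
    have h1 := bits_mul_cubeSide_div_noiseScale hN hε
    have h2 : bits N / noiseScale (bits N) ≤ bits N * cubeSide N ε / noiseScale (bits N) := by
      gcongr
      exact le_mul_of_one_le_right hd.le hr.le
    linarith
  set c := hitProb (noiseScale (bits N)) W (binMap bot) with hc
  have hle : ∀ x ∈ Set.Icc (0 : Fin (bits N) → ℝ) 1,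
      hitProb (noiseScale (bits N)) W x ≤ L * c := fun x hx =>
    hitProb_lipschitz_const hb W hx (binMap_mem_Icc bot)
  have hge : ∀ x ∈ Set.Icc (0 : Fin (bits N) → ℝ) 1,
      c ≤ L * hitProb (noiseScale (bits N)) W x := fun x hx =>
    hitProb_lipschitz_const hb W (binMap_mem_Icc bot) hx
  have hub : modeRelease ε bot D S ≤ L * c := by
    rw [modeRelease_apply hN hε]
    calc _ ≤ ENNReal.ofReal (1 - (2 : ℝ)⁻¹ ^ bits N) *
          (laplace (1 / ε) (passSet ε D) * (L * c) + laplace (1 / ε) (passSet ε D)ᶜ * (L * c)) +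
          ENNReal.ofReal ((2 : ℝ)⁻¹ ^ bits N) *
            ∫⁻ _ in Set.Icc (0 : Fin (bits N) → ℝ) 1, L * c := by
          gcongr _ * (_ * ?_ + _ * ?_) + _ * ?_
          · exact hle _ (binMap_mem_Icc _)
          · exact hle _ (binMap_mem_Icc _)
          · exact setLIntegral_mono' measurableSet_Icc hle
      _ = L * c := by
          rw [← add_mul, prob_add_prob_compl (measurableSet_passSet ε D), setLIntegral_const,
            volume_unitCube, one_mul, mul_one, ← add_mul, ofReal_mixture, one_mul]
  have hlb : c ≤ L * modeRelease ε bot D' S := by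
    rw [modeRelease_apply hN hε]
    calc c = ENNReal.ofReal (1 - (2 : ℝ)⁻¹ ^ bits N) *
          (laplace (1 / ε) (passSet ε D') * c + laplace (1 / ε) (passSet ε D')ᶜ * c) +
          ENNReal.ofReal ((2 : ℝ)⁻¹ ^ bits N) *
            ∫⁻ _ in Set.Icc (0 : Fin (bits N) → ℝ) 1, c := by
          rw [← add_mul, prob_add_prob_compl (measurableSet_passSet ε D'), setLIntegral_const,
            volume_unitCube, one_mul, mul_one, ← add_mul, ofReal_mixture, one_mul]
      _ ≤ ENNReal.ofReal (1 - (2 : ℝ)⁻¹ ^ bits N) *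
          (laplace (1 / ε) (passSet ε D') *
              (L * hitProb (noiseScale (bits N)) W (binMap (mode D'))) +
            laplace (1 / ε) (passSet ε D')ᶜ *
              (L * hitProb (noiseScale (bits N)) W (binMap bot))) +
          ENNReal.ofReal ((2 : ℝ)⁻¹ ^ bits N) *
            ∫⁻ x in Set.Icc 0 1, L * hitProb (noiseScale (bits N)) W x := by
          gcongr _ * (_ * ?_ + _ * ?_) + _ * ?_
          · exact hge _ (binMap_mem_Icc _)
          · exact hge _ (binMap_mem_Icc _)
          · exact setLIntegral_mono' measurableSet_Icc hge
      _ = _ := by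
          rw [lintegral_const_mul' _ _ ENNReal.ofReal_ne_top]; ring
  calc modeRelease ε bot D S ≤ L * (L * modeRelease ε bot D' S) := hub.trans (by gcongr)
    _ = L * L * modeRelease ε bot D' S := by ring
    _ ≤ _ := by gcongr

/-- Both laws are compared with the one in which the test always fails: the small mass at the mode
of D is moved to bot, and the small pass mass of D' is moved from bot to the mode of D'. -/
theorem modeRelease_le_of_mode_ne (hN : 2 ≤ N) (hε : 0 < ε) (bot : Fin N)
    (hr : cubeSide N ε ≤ 1) (hD : instabilityDist D ≤ 1) (hD' : instabilityDist D' ≤ 1)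
    (S : Set (Fin N)) :
    modeRelease ε bot D S ≤ ENNReal.ofReal (Real.exp ε) * modeRelease ε bot D' S := by
  have := isProbabilityMeasure_laplace (b := 1 / ε) (by positivity)
  have hb := noiseScale_pos (bits_pos hN)
  have hd : (0 : ℝ) < bits N := by exact_mod_cast bits_pos hN
  have hδ := logInvDelta_nonneg_of_cubeSide_le_one hN hε hr
  obtain ⟨k, hk, hk1, hk2⟩ := exists_nat_one_div_mem (cubeSide_pos hN hε) hr
  set W := decodeWords bot S
  set L := ENNReal.ofReal (Real.exp (bits N * (1 / k) / noiseScale (bits N))) with hL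
  have hL1 : 1 ≤ L := by
    rw [hL, ENNReal.one_le_ofReal, Real.one_le_exp_iff]; positivity
  -- Since 1/k ≤ 2r, each of the two moves costs at most 2 · ε/4, which adds up to ε.
  have hLL : L * L ≤ ENNReal.ofReal (Real.exp ε) := by
    rw [hL, ← ENNReal.ofReal_mul (by positivity), ← Real.exp_add]
    gcongr
    have h1 := bits_mul_cubeSide_div_noiseScale hN hε
    have h2 : bits N * (1 / k) / noiseScale (bits N) ≤
        bits N * (2 * cubeSide N ε) / noiseScale (bits N) := by gcongr
    have h3 : bits N * (2 * cubeSide N ε) / noiseScale (bits N) =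
        2 * (bits N * cubeSide N ε / noiseScale (bits N)) := by ring
    linarith
  set w₁ := ENNReal.ofReal (1 - (2 : ℝ)⁻¹ ^ bits N) with hw₁
  set w := ENNReal.ofReal ((2 : ℝ)⁻¹ ^ bits N) with hw
  have hw₁le : w₁ ≤ 1 := by
    rw [hw₁, ENNReal.ofReal_le_one]
    have : (0 : ℝ) ≤ 2⁻¹ ^ bits N := by positivity
    linarith
  -- The pass mass is at most δ/2 = ω r^d, and r ≤ 1/k, so it fits into one cube of the chain.
  have hmass : ∀ {E : Fin n → Fin N}, instabilityDist E ≤ 1 →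
      w₁ * laplace (1 / ε) (passSet ε E) ≤ w * ENNReal.ofReal ((1 / k : ℝ) ^ bits N) := by
    intro E hE
    refine (mul_le_of_le_one_left' hw₁le).trans <|
      (laplace_passSet_le_of_instabilityDist_le_one hε hE hδ).trans ?_
    rw [← mul_cubeSide_pow hN hε, ENNReal.ofReal_mul (by positivity)]
    have := (cubeSide_pos hN hε).le
    gcongr
  have hchain : ∀ (u v : Fin N) {p : ℝ≥0∞}, p ≤ w * ENNReal.ofReal ((1 / k : ℝ) ^ bits N) →
      p * hitProb (noiseScale (bits N)) W (binMap u) +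
          w * ∫⁻ x in Set.Icc 0 1, hitProb (noiseScale (bits N)) W x ≤
        L * (p * hitProb (noiseScale (bits N)) W (binMap v) +
          w * ∫⁻ x in Set.Icc 0 1, hitProb (noiseScale (bits N)) W x) := by
    intro u v p hp
    rw [binMap_eq u, binMap_eq v]
    exact mul_add_lintegral_le (m := fun i => (u : ℕ).testBit i)
      (v := fun i => (v : ℕ).testBit i) hb (hitProb_le hb W) hk hp
  have h1 := hchain (mode D) bot (hmass hD)
  have h2 := hchain bot (mode D') (hmass hD')
  have hP := prob_add_prob_compl (μ := laplace (1 / ε)) (measurableSet_passSet ε D)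
  have hQ := prob_add_prob_compl (μ := laplace (1 / ε)) (measurableSet_passSet ε D')
  rw [modeRelease_apply hN hε, modeRelease_apply hN hε]
  set I := ∫⁻ x in Set.Icc 0 1, hitProb (noiseScale (bits N)) W x
  set p := laplace (1 / ε) (passSet ε D)
  set p' := laplace (1 / ε) (passSet ε D)ᶜ
  set q := laplace (1 / ε) (passSet ε D')
  set q' := laplace (1 / ε) (passSet ε D')ᶜ
  set c := hitProb (noiseScale (bits N)) W (binMap bot)
  set a := hitProb (noiseScale (bits N)) W (binMap (mode D))
  set a' := hitProb (noiseScale (bits N)) W (binMap (mode D'))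
  calc w₁ * (p * a + p' * c) + w * I
      = w₁ * p' * c + (w₁ * p * a + w * I) := by ring
    _ ≤ L * (w₁ * p' * c) + L * (w₁ * p * c + w * I) :=
        add_le_add (le_mul_of_one_le_left' hL1) h1
    _ = L * (w₁ * (p + p') * c + w * I) := by ring
    _ = L * (w₁ * q' * c + (w₁ * q * c + w * I)) := by
        rw [hP, ← hQ]; ring
    _ ≤ L * (L * (w₁ * q' * c) + L * (w₁ * q * a' + w * I)) := by
        exact mul_le_mul_right (add_le_add (le_mul_of_one_le_left' hL1) h2) _
    _ = L * L * (w₁ * (q * a' + q' * c) + w * I) := by ring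
    _ ≤ _ := by gcongr

theorem isDP_modeRelease (hN : 2 ≤ N) (hε : 0 < ε) (bot : Fin N) :
    IsDP (2 * ε) 0 (fun D : Fin n → Fin N => modeRelease ε bot D) := by
  refine ⟨fun D => isProbabilityMeasure_modeRelease hN hε bot D, fun D D' h S _ => ?_⟩
  rw [ENNReal.ofReal_zero, add_zero]
  -- The constant obtained is exp ε; the stated 2ε leaves slack.
  have key : modeRelease ε bot D S ≤ ENNReal.ofReal (Real.exp ε) * modeRelease ε bot D' S := by
    by_cases heq : mode D = mode D'
    · exact modeRelease_le_of_mode_eq hN hε bot h heq S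
    · rcases le_or_gt (cubeSide N ε) 1 with hr | hr
      · exact modeRelease_le_of_mode_ne hN hε bot hr
          (instabilityDist_le_one_of_mode_ne h heq)
          (instabilityDist_le_one_of_mode_ne ((hammingDist_comm D' D).trans_le h)
            (Ne.symm heq)) S
      · exact modeRelease_le_of_one_lt_cubeSide hN hε bot hr S
  refine key.trans ?_
  gcongr
  linarith

end Privacy

/-! ### Utility -/

theorem le_two_pow_bits (N : ℕ) : N ≤ 2 ^ bits N := Nat.le_pow_clog one_lt_two N

theorem inv_two_pow_bits_le {N : ℕ} (hN : 2 ≤ N) : (2 : ℝ)⁻¹ ^ bits N ≤ 1 / N := by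
  have hN' : (0 : ℝ) < N := by exact_mod_cast (by omega : 0 < N)
  have : (N : ℝ) ≤ 2 ^ bits N := by exact_mod_cast le_two_pow_bits N
  rw [inv_pow, ← one_div]
  exact one_div_le_one_div_of_le hN' this

theorem two_thirds_lt_log_two : (2 : ℝ) / 3 < Real.log 2 := by
  have := Real.log_two_gt_d9
  linarith

/-- From 2^(d-1) < N and 2 ≤ N one gets d log 2 ≤ 2 log N, and log 2 > 2/3. -/
theorem bits_le_three_mul_log {N : ℕ} (hN : 2 ≤ N) : (bits N : ℝ) ≤ 3 * Real.log N := by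
  have hN' : (2 : ℝ) ≤ N := by exact_mod_cast hN
  have h1 : 2 ^ (bits N - 1) < N := Nat.pow_pred_clog_lt_self one_lt_two (by omega)
  have h2 : ((2 : ℝ) ^ (bits N - 1)) ≤ N := by exact_mod_cast h1.le
  have h3 := Real.log_le_log (by positivity) h2
  have h4 := Real.log_le_log (by norm_num) hN'
  rw [Real.log_pow, Nat.cast_sub (bits_pos hN), Nat.cast_one] at h3
  have h5 := two_thirds_lt_log_two
  have h6 : (1 : ℝ) ≤ bits N := by exact_mod_cast bits_pos hN
  nlinarith

theorem sq_div_le_inv_noiseScale {d : ℕ} (hd : 0 < d) :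
    (d : ℝ) ^ 2 / 16 ≤ 1 / 4 / noiseScale d := by
  have hd' : (0 : ℝ) < d := by exact_mod_cast hd
  rw [le_div_iff₀ (noiseScale_pos hd), noiseScale]
  have h : Real.exp (0 - Real.log 2 / d) ≤ 1 := by
    rw [Real.exp_le_one_iff, zero_sub, neg_nonpos]
    have := Real.log_nonneg one_le_two
    positivity
  have : (d : ℝ) ^ 2 / 16 * (4 * (Real.exp (0 - Real.log 2 / d) / d / d)) =
      Real.exp (0 - Real.log 2 / d) / 4 := by field_simp; norm_num
  rw [this]
  linarith

/-- A bit is flipped by the noise with exponentially small probability. -/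
theorem one_sub_exp_le_laplace_round {b : ℝ} (hb : 0 < b) (c : Bool) :
    1 - Real.exp (-(1 / 4 / b)) / 2 ≤
      (laplace b).real ((fun z => (c.toNat : ℝ) + z) ⁻¹' {y | decide (1 / 2 ≤ y) = c}) := by
  have := isProbabilityMeasure_laplace hb
  cases c
  -- The distance to the rounding threshold is 1/2; using 1/4 leaves room, so the endpoint, which is
  -- rounded up, needs no care.
  · have hsub : (Set.Ioi (1 / 4 : ℝ))ᶜ ⊆
        (fun z => ((false.toNat : ℕ) : ℝ) + z) ⁻¹' {y | decide (1 / 2 ≤ y) = false} := by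
      intro z hz
      simp only [Set.compl_Ioi, Set.mem_Iic] at hz
      simp
      linarith
    refine le_trans ?_ (measureReal_mono hsub)
    rw [probReal_compl_eq_one_sub measurableSet_Ioi, measureReal_def,
      laplace_Ioi hb (by norm_num), ENNReal.toReal_ofReal (by positivity), neg_div]
  · have hsub : (Set.Iic (-(1 / 4) : ℝ))ᶜ ⊆
        (fun z => ((true.toNat : ℕ) : ℝ) + z) ⁻¹' {y | decide (1 / 2 ≤ y) = true} := by
      intro z hz
      simp only [Set.compl_Iic, Set.mem_Ioi] at hz
      simp
      linarith
    refine le_trans ?_ (measureReal_mono hsub)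
    rw [probReal_compl_eq_one_sub measurableSet_Iic, measureReal_def,
      laplace_Iic hb (by norm_num), ENNReal.toReal_ofReal (by positivity), neg_div]

theorem decode_testBit {N : ℕ} (bot u : Fin N) :
    decode bot (fun i => (u : ℕ).testBit i) = u := by
  have h : Nat.ofBits (fun i : Fin (bits N) => (u : ℕ).testBit i) = u := by
    rw [Nat.ofBits_testBit]
    exact Nat.mod_eq_of_lt (u.2.trans_le (le_two_pow_bits N))
  simp [decode, h]

/-- Both d and N are at most exp d, so the claim reduces to 2d - d²/16 ≤ 16, that is, (d - 16)² ≥ 0.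
This is the origin of the constant exp 16. -/
theorem mul_exp_neg_inv_noiseScale_le {N : ℕ} (hN : 2 ≤ N) :
    bits N * (Real.exp (-(1 / 4 / noiseScale (bits N))) / 2) ≤ Real.exp 16 / N := by
  have hN' : (0 : ℝ) < N := by exact_mod_cast (by omega : 0 < N)
  have hle := sq_div_le_inv_noiseScale (bits_pos hN)
  have hpow : (N : ℝ) ≤ Real.exp (bits N) := by
    have h3 : (N : ℝ) ≤ 2 ^ bits N := by exact_mod_cast le_two_pow_bits N
    have h4 : (2 : ℝ) ^ bits N ≤ Real.exp 1 ^ bits N := by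
      gcongr
      have := Real.add_one_le_exp 1
      linarith
    rw [← Real.exp_nat_mul, mul_one] at h4
    exact h3.trans h4
  generalize bits N = d at *
  have hd1 : (d : ℝ) ≤ Real.exp d := by
    have := Real.add_one_le_exp (d : ℝ)
    linarith
  have he2 : Real.exp (-(1 / 4 / noiseScale d)) / 2 ≤ Real.exp (-((d : ℝ) ^ 2 / 16)) := by
    have h5 : Real.exp (-(1 / 4 / noiseScale d)) ≤ Real.exp (-((d : ℝ) ^ 2 / 16)) :=
      Real.exp_le_exp.2 (by linarith)
    have := Real.exp_pos (-(1 / 4 / noiseScale d))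
    linarith
  rw [le_div_iff₀ hN']
  calc (d : ℝ) * (Real.exp (-(1 / 4 / noiseScale d)) / 2) * N ≤
      Real.exp d * Real.exp (-((d : ℝ) ^ 2 / 16)) * Real.exp d := by gcongr
    _ = Real.exp (d + -((d : ℝ) ^ 2 / 16) + d) := by rw [Real.exp_add, Real.exp_add]
    _ ≤ Real.exp 16 := by
        rw [Real.exp_le_exp]
        nlinarith [sq_nonneg ((d : ℝ) - 16)]

theorem mem_decodeWords {N : ℕ} {bot : Fin N} {S : Set (Fin N)} {w : Fin (bits N) → Bool} :
    w ∈ decodeWords bot S ↔ decode bot w ∈ S := by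
  simp [decodeWords]

/-- Only the word of u itself is kept in the sum, and Bernoulli's inequality bounds the product over
its bits. -/
theorem one_sub_le_hitProb {N : ℕ} (hN : 2 ≤ N) (bot u : Fin N) :
    1 - Real.exp 16 / N ≤
      (hitProb (noiseScale (bits N)) (decodeWords bot {u}) (binMap u)).toReal := by
  have hb := noiseScale_pos (bits_pos hN)
  have hnum := mul_exp_neg_inv_noiseScale_le hN
  generalize noiseScale (bits N) = b at hb hnum ⊢
  have hmem : (fun i : Fin (bits N) => (u : ℕ).testBit i) ∈ decodeWords bot {u} := by
    rw [mem_decodeWords, decode_testBit]; rfl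
  have h1 := Finset.single_le_sum (f := fun w => ∏ i : Fin (bits N),
      laplace b ((fun z => binMap u i + z) ⁻¹' {y | decide (1 / 2 ≤ y) = w i}))
      (fun _ _ => bot_le) hmem
  have h2 := ENNReal.toReal_mono
    (ne_top_of_le_ne_top ENNReal.one_ne_top (hitProb_le_one hb _ _)) h1
  clear h1 hmem
  refine le_trans ?_ h2
  rw [ENNReal.toReal_prod]
  have he1 : Real.exp (-(1 / 4 / b)) ≤ 1 :=
    Real.exp_le_one_iff.2 (neg_nonpos.2 (by positivity))
  have h4 : ∏ _i : Fin (bits N), (1 - Real.exp (-(1 / 4 / b)) / 2) ≤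
      ∏ i : Fin (bits N), (laplace b ((fun z => binMap u i + z) ⁻¹'
        {y | decide (1 / 2 ≤ y) = (u : ℕ).testBit i})).toReal := by
    refine Finset.prod_le_prod (fun i _ => by linarith) fun i _ => ?_
    have h3 := one_sub_exp_le_laplace_round hb ((u : ℕ).testBit i)
    rw [measureReal_def] at h3
    rwa [binMap_eq]
  refine le_trans ?_ h4
  rw [Finset.prod_const, Finset.card_univ, Fintype.card_fin, sub_eq_add_neg (1 : ℝ) (_ / 2)]
  refine le_trans ?_ (one_add_mul_le_pow (by linarith) _)
  linarith

theorem one_sub_le_laplace_passSet {n N : ℕ} [NeZero N] (hN : 2 ≤ N) {ε : ℝ} (hε : 0 < ε)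
    {D : Fin n → Fin N}
    (h : ε + logInvDelta N ε + Real.log N ≤ ε * (((occ₁ D : ℝ) - occ₂ D) / 2)) :
    1 - 1 / (N : ℝ) ≤ (laplace (1 / ε)).real (passSet ε D) := by
  have := isProbabilityMeasure_laplace (b := 1 / ε) (by positivity)
  have hN' : (0 : ℝ) < N := by exact_mod_cast (by omega : 0 < N)
  have hlog : 0 ≤ Real.log N := Real.log_natCast_nonneg N
  have hinst : ((occ₁ D : ℝ) - occ₂ D) / 2 ≤ instabilityDist D := Int.le_ceil _
  have hgap := h.trans (mul_le_mul_of_nonneg_left hinst hε.le)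
  set t := logInvDelta N ε / ε - ((instabilityDist D : ℝ) - 1) with ht
  have htε : t / (1 / ε) ≤ -Real.log N := by
    have : t / (1 / ε) = logInvDelta N ε - ε * instabilityDist D + ε := by
      rw [ht]; field_simp; ring
    rw [this]; linarith
  have ht0 : t ≤ 0 := by
    by_contra hcon
    have : 0 < t / (1 / ε) := by push Not at hcon; positivity
    linarith
  rw [passSet_eq, ← ht, ← Set.compl_Iic, probReal_compl_eq_one_sub measurableSet_Iic,
    measureReal_def, laplace_Iic (by positivity) ht0, ENNReal.toReal_ofReal (by positivity)]
  have h1 : Real.exp (t / (1 / ε)) ≤ 1 / N := by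
    refine (Real.exp_le_exp.2 htε).trans_eq ?_
    rw [Real.exp_neg, Real.exp_log hN', one_div]
  have := Real.exp_pos (t / (1 / ε))
  linarith

/-- With d ≤ 3 log N, the argument of the logarithm is at most 54 (log N)³ / ε = 54 ε² (log N / ε)³,
and ε² is bounded through ε₀. -/
theorem logInvDelta_le {N : ℕ} (hN : 2 ≤ N) {ε ε₀ : ℝ} (hε : 0 < ε) (hεε₀ : ε ≤ ε₀)
    (hL : 0 ≤ Real.log (Real.log N / ε)) :
    logInvDelta N ε ≤ 3 * Real.log N *
      (Real.log 54 + 2 * Real.log (max ε₀ 1) + 3 * Real.log (Real.log N / ε)) := by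
  have hd : (0 : ℝ) < bits N := by exact_mod_cast bits_pos hN
  have hlogN : 0 < Real.log N := Real.log_pos (by exact_mod_cast (by omega : 1 < N))
  have hd3 := bits_le_three_mul_log hN
  have h1 : 2 * (bits N : ℝ) ^ 3 / ε ≤ 54 * (max ε₀ 1) ^ 2 * (Real.log N / ε) ^ 3 := by
    calc 2 * (bits N : ℝ) ^ 3 / ε ≤ 2 * (3 * Real.log N) ^ 3 / ε := by gcongr
      _ = 54 * ε ^ 2 * (Real.log N / ε) ^ 3 := by field_simp; norm_num
      _ ≤ _ := by
        gcongr
        exact hεε₀.trans (le_max_left _ _)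
  have hm : 0 < max ε₀ 1 := lt_max_of_lt_right one_pos
  have h2 := Real.log_le_log (by positivity) h1
  rw [Real.log_mul (by positivity) (by positivity), Real.log_mul (by positivity) (by positivity),
    Real.log_pow, Real.log_pow] at h2
  have h3 : 0 ≤ Real.log (max ε₀ 1) := Real.log_nonneg (le_max_right _ _)
  have h4 : 0 ≤ Real.log 54 := Real.log_nonneg (by norm_num)
  push_cast at h2
  rw [logInvDelta]
  calc (bits N : ℝ) * Real.log (2 * (bits N : ℝ) ^ 3 / ε)
      ≤ bits N * (Real.log 54 + 2 * Real.log (max ε₀ 1) + 3 * Real.log (Real.log N / ε)) := by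
        gcongr
    _ ≤ _ := by gcongr

/-- Only the summand in which the vertex is used and the test passes is kept; the deficits of its
three factors add up. -/
theorem one_sub_le_modeRelease_mode {n N : ℕ} [NeZero N] (hN : 2 ≤ N) {ε : ℝ} (hε : 0 < ε)
    (bot : Fin N) {D : Fin n → Fin N}
    (h : ε + logInvDelta N ε + Real.log N ≤ ε * (((occ₁ D : ℝ) - occ₂ D) / 2)) :
    1 - (2 + Real.exp 16) / N ≤ (modeRelease ε bot D).real {mode D} := by
  have := isProbabilityMeasure_laplace (b := 1 / ε) (by positivity)
  have := isProbabilityMeasure_modeRelease hN hε bot D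
  have hb := noiseScale_pos (bits_pos hN)
  have hω := inv_two_pow_bits_le hN
  have hω0 : (0 : ℝ) ≤ (2 : ℝ)⁻¹ ^ bits N := by positivity
  have hω1 : (2 : ℝ)⁻¹ ^ bits N ≤ 1 := pow_le_one₀ (by norm_num) (by norm_num)
  have hp := one_sub_le_laplace_passSet hN hε h
  have hh := one_sub_le_hitProb hN bot (mode D)
  have hle : ENNReal.ofReal (1 - (2 : ℝ)⁻¹ ^ bits N) *
      (laplace (1 / ε) (passSet ε D) *
        hitProb (noiseScale (bits N)) (decodeWords bot {mode D}) (binMap (mode D))) ≤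
        modeRelease ε bot D {mode D} := by
    rw [modeRelease_apply hN hε, mul_add, add_assoc]
    exact le_self_add
  have hle' := ENNReal.toReal_mono (measure_ne_top _ _) hle
  rw [ENNReal.toReal_mul, ENNReal.toReal_mul, ENNReal.toReal_ofReal (by linarith)] at hle'
  refine le_trans ?_ hle'
  rw [measureReal_def] at hp
  set p := (laplace (1 / ε) (passSet ε D)).toReal
  set q := (hitProb (noiseScale (bits N)) (decodeWords bot {mode D}) (binMap (mode D))).toReal
  set ω := (2 : ℝ)⁻¹ ^ bits N
  have hp1 : p ≤ 1 := measureReal_le_one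
  have hq1 : q ≤ 1 :=
    ENNReal.toReal_le_of_le_ofReal zero_le_one
      ((hitProb_le_one hb _ _).trans_eq ENNReal.ofReal_one.symm)
  have hp0 : 0 ≤ p := ENNReal.toReal_nonneg
  have hq0 : 0 ≤ q := ENNReal.toReal_nonneg
  have hsplit : (2 + Real.exp 16) / N = 1 / N + 1 / N + Real.exp 16 / N := by ring
  have h1 : p + q - 1 ≤ p * q := by nlinarith
  have h2 : p * q ≤ 1 := mul_le_one₀ hp1 hq0 hq1
  nlinarith

theorem exists_utility_constant {ε₀ c : ℝ} (hc : 1 < c) :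
    ∃ C : ℝ, ∀ (N : ℕ) [NeZero N] (n : ℕ) (ε : ℝ) (bot : Fin N) (D : Fin n → Fin N),
      2 ≤ N → 0 < ε → ε ≤ ε₀ → c * ε ≤ Real.log N →
      C * (Real.log N * Real.log (Real.log N / ε) / ε) < (occ₁ D : ℝ) - occ₂ D →
      1 - (2 + Real.exp 16) / N ≤ (modeRelease ε bot D).real {mode D} := by
  have hlc : 0 < Real.log c := Real.log_pos hc
  set c₁ := Real.log 54 + 2 * Real.log (max ε₀ 1) with hc₁
  have hc₁0 : 0 ≤ c₁ := by
    have h3 : 0 ≤ Real.log (max ε₀ 1) := Real.log_nonneg (le_max_right _ _)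
    have h4 : 0 ≤ Real.log 54 := Real.log_nonneg (by norm_num)
    positivity
  -- The requirement is at most (2 + 3c₁) L + 9 L M. The bound M ≥ log c > 0 turns the first term
  -- into a multiple of L M, and the leading 2 undoes the halving of the gap.
  refine ⟨2 * ((2 + 3 * c₁) / Real.log c + 9), fun N _ n ε bot D hN hε hε₀ hcε hgap => ?_⟩
  refine one_sub_le_modeRelease_mode hN hε bot ?_
  set L := Real.log N with hL
  have hL0 : 0 < L := Real.log_pos (by exact_mod_cast (by omega : 1 < N))
  set M := Real.log (L / ε) with hM
  have hcM : Real.log c ≤ M :=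
    Real.log_le_log (by linarith) (by rwa [le_div_iff₀ hε])
  have hM0 : 0 ≤ M := hlc.le.trans hcM
  have hδ := logInvDelta_le hN hε hε₀ hM0
  have hεL : ε ≤ L := by nlinarith
  have hratio : 1 ≤ M / Real.log c := by rwa [le_div_iff₀ hlc, one_mul]
  have h1 : (2 + 3 * c₁) * L ≤ (2 + 3 * c₁) * L * (M / Real.log c) :=
    le_mul_of_one_le_right (by positivity) hratio
  have h2 : ε * (2 * ((2 + 3 * c₁) / Real.log c + 9) * (L * M / ε) / 2) =
      (2 + 3 * c₁) * L * (M / Real.log c) + 9 * (L * M) := by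
    field_simp
  have h3 : ε * (2 * ((2 + 3 * c₁) / Real.log c + 9) * (L * M / ε) / 2) ≤
      ε * (((occ₁ D : ℝ) - occ₂ D) / 2) := by gcongr
  have h4 : 3 * L * (c₁ + 3 * M) = 3 * c₁ * L + 9 * (L * M) := by ring
  linarith

/-! ### Reasoning about programs -/

/-- The program `P` leads from `s` to a configuration with the property `Q` within `c` steps. -/
def Reach (P : List Instr) (τ : Tape) (s : Config) (Q : Config → Prop) (c : ℕ) : Prop :=
  ∃ t ≤ c, Q (run P τ s t)

namespace Reach

variable {P : List Instr} {τ : Tape} {s : Config} {Q R : Config → Prop} {c c' : ℕ}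

theorem done (h : Q s) : Reach P τ s Q c := ⟨0, Nat.zero_le _, h⟩

theorem mono (h : Reach P τ s Q c) (hc : c ≤ c') : Reach P τ s Q c' :=
  h.imp fun _ ht => ⟨ht.1.trans hc, ht.2⟩

theorem step {I : Instr} (hI : P[s.pc]? = some I) (h : Reach P τ (I.exec τ s) Q c) :
    Reach P τ s Q (c + 1) := by
  obtain ⟨t, ht, hQ⟩ := h
  refine ⟨t + 1, by omega, ?_⟩
  rw [run, Function.iterate_succ_apply]
  have : ModeRelease.step P τ s = I.exec τ s := by simp [ModeRelease.step, hI]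
  rw [this]
  exact hQ

theorem jumpLE {i j l : ℕ} (hI : P[s.pc]? = some (.jumpLE i j l))
    (h : s.reg i ≤ s.reg j → Reach P τ { s with pc := l } Q c)
    (h' : ¬ s.reg i ≤ s.reg j → Reach P τ s.next Q c) : Reach P τ s Q (c + 1) := by
  refine step hI ?_
  by_cases hle : s.reg i ≤ s.reg j
  · simpa [Instr.exec, hle] using h hle
  · simpa [Instr.exec, hle] using h' hle

theorem jumpLER {i j l : ℕ} (hI : P[s.pc]? = some (.jumpLER i j l))
    (h : s.xreg i ≤ s.xreg j → Reach P τ { s with pc := l } Q c)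
    (h' : ¬ s.xreg i ≤ s.xreg j → Reach P τ s.next Q c) : Reach P τ s Q (c + 1) := by
  refine step hI ?_
  by_cases hle : s.xreg i ≤ s.xreg j
  · simpa [Instr.exec, hle] using h hle
  · simpa [Instr.exec, hle] using h' hle

theorem trans (h : Reach P τ s Q c) (h' : ∀ s', Q s' → Reach P τ s' R c') :
    Reach P τ s R (c + c') := by
  obtain ⟨t, ht, hQ⟩ := h
  obtain ⟨t', ht', hR⟩ := h' _ hQ
  refine ⟨t' + t, by omega, ?_⟩
  rwa [run, Function.iterate_add_apply]

/-- The invariants used here fix the program counter at the loop head, also after the last pass; the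
exit test belongs to the next phase. -/
theorem loop {J : ℕ → Config → Prop} {m : ℕ}
    (h : ∀ i < m, ∀ s, J i s → Reach P τ s (J (i + 1)) c) (h0 : J 0 s) :
    Reach P τ s (J m) (m * c) := by
  induction m with
  | zero => exact done h0
  | succ m ih =>
    rw [Nat.succ_mul]
    exact (ih fun i hi => h i (by omega)).trans (h m (by omega))

end Reach

/-- A halted machine stays where it is. -/
theorem run_of_halted {P : List Instr} {τ : Tape} {s : Config} {t T : ℕ} (hT : t ≤ T)
    (h : Halted P (run P τ s t)) : run P τ s T = run P τ s t := by
  obtain ⟨l, rfl⟩ := Nat.exists_eq_add_of_le hT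
  rw [run, Nat.add_comm, Function.iterate_add_apply]
  change (step P τ)^[l] (run P τ s t) = run P τ s t
  have : step P τ (run P τ s t) = run P τ s t := by
    unfold step
    rw [List.getElem?_eq_none h]
  exact Function.iterate_fixed this l

/-! ### The program -/

/-- A program for the mode release algorithm. -/
def modeProgram : List Instr :=
  [ -- counting, and the mode of the records read so far
    .const 3 1,
    .jumpLE 0 4 16,
    .load 7 4,
    -- The counter of item x is cell n + x, behind the records.
    .add 8 0 7,
    .load 9 8,
    .add 9 9 3,
    .store 8 9,
    -- Register 12 is always 0, so adding it copies a register. Three cases follow from ≤ alone: a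
    -- larger count replaces the mode, after which the tie test changes nothing; a strictly smaller
    -- one is skipped; a tie replaces the mode only by a smaller item.
    .jumpLE 9 6 10,
    .add 5 7 12,
    .add 6 9 12,
    .add 8 9 3,
    .jumpLE 8 6 14,
    .jumpLE 5 7 14,
    .add 5 7 12,
    .add 4 4 3,
    .jump 1,
    -- the frequency of the second most frequent item
    .const 4 0,
    .add 8 0 5,
    .store 8 12,
    .jumpLE 0 4 27,
    .load 7 4,
    .add 8 0 7,
    .load 9 8,
    .jumpLE 9 11 25,
    .add 11 9 12,
    .add 4 4 3,
    .jump 19,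
    -- the number of bits
    .const 14 1,
    .jumpLE 1 14 32,
    .add 14 14 14,
    .add 13 13 3,
    .jump 28,
    -- the distance-to-instability test
    .sub 8 6 11,
    .add 8 8 3,
    .half 8 8,
    .cast 1 13,
    .cast 2 3,
    .addR 3 2 2,
    .mulR 4 1 1,
    .mulR 4 4 1,
    .mulR 4 3 4,
    .divR 4 4 0,
    .logR 4 4,
    .mulR 4 1 4,
    .divR 4 4 0,
    .cast 5 8,
    .subR 5 5 2,
    .drawLap 6,
    .divR 6 6 0,
    .addR 5 5 6,
    .add 15 2 12,
    .jumpLER 5 4 53,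
    .add 15 5 12,
    -- the parameters of the purification, and the choice of the part of the mixture
    .logR 7 3,
    .divR 7 7 1,
    .subR 7 9 7,
    .expR 7 7,
    .divR 7 7 1,
    .divR 7 7 1,
    .addR 8 3 3,
    .mulR 7 8 7,
    .cast 10 14,
    .divR 10 2 10,
    .divR 11 2 3,
    .drawUnif 6,
    .const 16 1,
    .jumpLER 6 10 68,
    .const 16 0,
    .const 4 0,
    .const 18 1,
    -- noise and rounding, bit by bit
    .jumpLE 13 4 87,
    -- The uniform number is drawn even when it is discarded, so bit j always uses the tape entries
    -- 2j + 2 and 2j + 3; entries 0 and 1 serve the test and the mixture.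
    .drawUnif 6,
    .drawLap 5,
    .half 8 15,
    .add 9 8 8,
    .sub 9 15 9,
    .jumpLE 3 16 78,
    .cast 6 9,
    .mulR 5 7 5,
    .addR 6 6 5,
    .add 15 8 12,
    .jumpLER 11 6 83,
    .jump 84,
    .add 17 17 18,
    .add 18 18 18,
    .add 4 4 3,
    .jump 70,
    -- the output
    .add 0 2 12,
    .jumpLE 1 17 90,
    .add 0 17 12]

/-! ### Counting -/

section Counting

variable {n N : ℕ}

/-- The number of occurrences of `y` among the first `i` records. -/
def prefixFreq (D : Fin n → Fin N) (i y : ℕ) : ℕ :=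
  (Finset.univ.filter fun j : Fin n => (j : ℕ) < i ∧ (D j : ℕ) = y).card

theorem prefixFreq_zero (D : Fin n → Fin N) (y : ℕ) : prefixFreq D 0 y = 0 := by
  simp [prefixFreq]

theorem prefixFreq_succ (D : Fin n → Fin N) (i : Fin n) (y : ℕ) :
    prefixFreq D (i + 1) y = prefixFreq D i y + if (D i : ℕ) = y then 1 else 0 := by
  unfold prefixFreq
  split_ifs with h
  · rw [← Finset.card_insert_of_notMem (a := i) (by simp)]
    congr 1
    ext j
    simp only [Finset.mem_filter, Finset.mem_univ, true_and, Finset.mem_insert, Fin.ext_iff,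
      Order.lt_add_one_iff]
    constructor
    · rintro ⟨h1, h2⟩
      rcases Nat.lt_or_ge j i with h3 | h3
      · exact Or.inr ⟨h3, h2⟩
      · exact Or.inl (by omega)
    · rintro (h1 | ⟨h1, h2⟩)
      · exact ⟨by omega, by rw [Fin.ext h1]; exact h⟩
      · exact ⟨by omega, h2⟩
  · refine (congrArg Finset.card (Finset.ext fun j => ?_)).trans (Nat.add_zero _).symm
    simp only [Finset.mem_filter, Finset.mem_univ, true_and, Order.lt_add_one_iff]
    constructor
    · rintro ⟨h1, h2⟩
      refine ⟨lt_of_le_of_ne h1 fun h3 => h ?_, h2⟩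
      rw [← h2, Fin.ext h3]
    · rintro ⟨h1, h2⟩
      exact ⟨h1.le, h2⟩

theorem prefixFreq_length (D : Fin n → Fin N) (x : Fin N) : prefixFreq D n x = freq D x := by
  simp [prefixFreq, freq, Fin.ext_iff]

/-- `md` is the mode, and `best` its frequency, among the first `i` records. -/
structure IsPrefixMode (D : Fin n → Fin N) (i md best : ℕ) : Prop where
  lt : md < N
  eq : best = prefixFreq D i md
  le : ∀ y, prefixFreq D i y ≤ best
  min : ∀ y, y < N → prefixFreq D i y = best → md ≤ y

theorem isPrefixMode_zero [NeZero N] (D : Fin n → Fin N) : IsPrefixMode D 0 0 0 :=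
  ⟨NeZero.pos N, by simp [prefixFreq_zero], by simp [prefixFreq_zero], by simp⟩

theorem IsPrefixMode.succ_of_le {D : Fin n → Fin N} {i : Fin n} {md best : ℕ}
    (h : IsPrefixMode D i md best) (hle : prefixFreq D (i + 1) (D i) ≤ best)
    (hmd : prefixFreq D (i + 1) (D i) = best → md ≤ D i) : IsPrefixMode D (i + 1) md best := by
  obtain ⟨hlt, heq, hfl, hmin⟩ := h
  have hsucc := prefixFreq_succ D i
  have hx := hsucc (D i)
  rw [if_pos rfl] at hx
  -- A further occurrence of the current mode would exceed `best`.
  have hne : (D i : ℕ) ≠ md := fun hcon => by rw [← hcon] at heq; omega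
  refine ⟨hlt, ?_, fun y => ?_, fun y hy hyb => ?_⟩
  · rw [hsucc, if_neg hne, heq, Nat.add_zero]
  · by_cases hy : (D i : ℕ) = y
    · rwa [← hy]
    · rw [hsucc, if_neg hy]; exact hfl y
  · by_cases hyx : (D i : ℕ) = y
    · rw [← hyx] at hyb ⊢; exact hmd hyb
    · rw [hsucc, if_neg hyx] at hyb; exact hmin y hy hyb

theorem IsPrefixMode.succ_of_ge {D : Fin n → Fin N} {i : Fin n} {md best : ℕ}
    (h : IsPrefixMode D i md best) (hle : best ≤ prefixFreq D (i + 1) (D i))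
    (hmd : prefixFreq D (i + 1) (D i) = best → D i ≤ md) :
    IsPrefixMode D (i + 1) (D i) (prefixFreq D (i + 1) (D i)) := by
  obtain ⟨hlt, heq, hfl, hmin⟩ := h
  have hsucc := prefixFreq_succ D i
  refine ⟨(D i).2, rfl, fun y => ?_, fun y hy hyb => ?_⟩
  · by_cases hy : (D i : ℕ) = y
    · rw [← hy]
    · rw [hsucc y, if_neg hy]; exact (hfl y).trans hle
  · by_cases hyx : (D i : ℕ) = y
    · exact hyx.le
    · rw [hsucc y, if_neg hyx] at hyb
      have := hfl y
      exact (hmd (by omega)).trans (hmin y hy (by omega))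

theorem mode_eq_of_forall [NeZero N] {D : Fin n → Fin N} {x : Fin N}
    (h1 : ∀ y, freq D y ≤ freq D x) (h2 : ∀ y, freq D y = freq D x → x ≤ y) : mode D = x := by
  refine le_antisymm (Finset.min'_le _ _ (by simpa [modes] using h1)) ?_
  exact h2 _ (le_antisymm (h1 _) (freq_le_freq_mode D x))

end Counting

/-- What holds from the initialization to the drawing of the random numbers. -/
structure Frame {n N : ℕ} (ε : ℝ) (bot : Fin N) (D : Fin n → Fin N) (s : Config) : Prop where
  reg0 : s.reg 0 = n
  reg1 : s.reg 1 = N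
  reg2 : s.reg 2 = bot
  reg3 : s.reg 3 = 1
  reg12 : s.reg 12 = 0
  reg17 : s.reg 17 = 0
  xreg0 : s.xreg 0 = ε
  xreg9 : s.xreg 9 = 0
  draws : s.draws = 0
  mem : ∀ j : Fin n, s.mem j = D j

/-- The invariant of the counting loop. -/
structure CountInv {n N : ℕ} (ε : ℝ) (bot : Fin N) (D : Fin n → Fin N) (i : ℕ) (s : Config) :
    Prop where
  frame : Frame ε bot D s
  pc : s.pc = 1
  reg4 : s.reg 4 = i
  reg11 : s.reg 11 = 0
  reg13 : s.reg 13 = 0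
  count : ∀ y, s.mem (n + y) = prefixFreq D i y
  mode : IsPrefixMode D i (s.reg 5) (s.reg 6)

/-! ### Symbolic execution: counting, second frequency, number of bits -/

section Program

variable {n N : ℕ} {ε : ℝ} {bot : Fin N} {D : Fin n → Fin N} {τ : Tape}

theorem reach_countInv_zero [NeZero N] :
    Reach modeProgram τ (input ε bot D) (CountInv ε bot D 0) 1 := by
  refine Reach.step rfl (Reach.done ?_)
  constructor
  · constructor <;> simp [Instr.exec, Config.setReg, Config.next, input]
  all_goals simp [Instr.exec, Config.setReg, Config.next, input, prefixFreq_zero, isPrefixMode_zero]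

theorem reach_countInv_of_counted {i : ℕ} (hi : i < n) {s : Config} (hs : Frame ε bot D s)
    (hpc : s.pc = 7) (h4 : s.reg 4 = i) (h7 : s.reg 7 = D ⟨i, hi⟩)
    (h9 : s.reg 9 = prefixFreq D (i + 1) (D ⟨i, hi⟩)) (h11 : s.reg 11 = 0) (h13 : s.reg 13 = 0)
    (hc : ∀ y, s.mem (n + y) = prefixFreq D (i + 1) y)
    (hmode : IsPrefixMode D i (s.reg 5) (s.reg 6)) :
    Reach modeProgram τ s (CountInv ε bot D (i + 1)) 9 := by
  obtain ⟨h0, h1, h2, h3, h12, h17, hx0, hx9, hd, hm⟩ := hs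
  -- Once the configuration is taken apart and its program counter is a literal, every instruction
  -- fetch holds by `rfl`.
  obtain ⟨pc, r, m, x, k⟩ := s
  dsimp only at *
  subst hpc
  have hkeep := hmode.succ_of_le (i := ⟨i, hi⟩)
  have hrepl := hmode.succ_of_ge (i := ⟨i, hi⟩)
  refine Reach.jumpLE rfl (fun h => ?_) fun h => ?_
  · refine Reach.step rfl ?_
    refine Reach.jumpLE rfl (fun h' => ?_) fun h' => ?_
    · refine Reach.step rfl (Reach.step rfl (Reach.done ?_))
      simp [Instr.exec, Config.setReg, Config.next, h3, h9] at h h'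
      constructor
      · constructor <;> simp [Instr.exec, Config.setReg, Config.next, *]
      · rfl
      iterate 4 simp [Instr.exec, Config.setReg, Config.next, *]
      simpa [Instr.exec, Config.setReg, Config.next] using hkeep h fun hcon => by
        dsimp only at hcon; omega
    · simp [Instr.exec, Config.setReg, Config.next, h3, h9] at h h'
      refine Reach.jumpLE rfl (fun h'' => ?_) fun h'' => ?_
      · simp [Instr.exec, Config.setReg, Config.next, h7] at h''
        refine Reach.step rfl (Reach.step rfl (Reach.done ?_))
        constructor
        · constructor <;> simp [Instr.exec, Config.setReg, Config.next, *]
        · rfl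
        iterate 4 simp [Instr.exec, Config.setReg, Config.next, *]
        simpa [Instr.exec, Config.setReg, Config.next] using hkeep h fun _ => h''
      · simp [Instr.exec, Config.setReg, Config.next, h7] at h''
        refine Reach.step rfl (Reach.step rfl (Reach.step rfl (Reach.done ?_)))
        have hb : prefixFreq D (i + 1) (D ⟨i, hi⟩) = r 6 := by omega
        constructor
        · constructor <;> simp [Instr.exec, Config.setReg, Config.next, *]
        · rfl
        iterate 4 simp [Instr.exec, Config.setReg, Config.next, *]
        simpa [Instr.exec, Config.setReg, Config.next, hb, h7, h12] using
          hrepl hb.ge fun _ => h''.le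
  · simp [h9] at h
    iterate 3 refine Reach.step rfl ?_
    refine Reach.jumpLE rfl (fun h' => ?_) fun h' => ?_
    · simp [Instr.exec, Config.setReg, Config.next, h3, h12] at h'
    refine Reach.jumpLE rfl (fun h' => ?_) fun h' => ?_
    · refine Reach.step rfl (Reach.step rfl (Reach.done ?_))
      constructor
      · constructor <;> simp [Instr.exec, Config.setReg, Config.next, *]
      · rfl
      iterate 4 simp [Instr.exec, Config.setReg, Config.next, *]
      simpa [Instr.exec, Config.setReg, Config.next, h7, h9, h12] using
        hrepl h.le fun hcon => by dsimp only at hcon; omega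
    · simp [Instr.exec, Config.setReg, Config.next, h12] at h'

theorem reach_countInv_succ {i : ℕ} (hi : i < n) {s : Config} (hs : CountInv ε bot D i s) :
    Reach modeProgram τ s (CountInv ε bot D (i + 1)) 15 := by
  obtain ⟨⟨h0, h1, h2, h3, h12, h17, hx0, hx9, hd, hm⟩, hpc, h4, h11, h13, hc, hmode⟩ := hs
  obtain ⟨pc, r, m, x, k⟩ := s
  dsimp only at *
  subst hpc
  have hload : m i = D ⟨i, hi⟩ := hm ⟨i, hi⟩
  have hsucc : ∀ y, prefixFreq D (i + 1) y =
      prefixFreq D i y + if (D ⟨i, hi⟩ : ℕ) = y then 1 else 0 := prefixFreq_succ D ⟨i, hi⟩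
  refine Reach.jumpLE rfl (fun h => by dsimp only at h; omega) fun _ => ?_
  iterate 5 refine Reach.step rfl ?_
  refine reach_countInv_of_counted hi ?_ rfl ?_ ?_ ?_ ?_ ?_ ?_ ?_
  · constructor <;> simp [Instr.exec, Config.setReg, Config.next, *]
    intro j
    rw [Function.update_of_ne (by omega), hm]
  all_goals simp [Instr.exec, Config.setReg, Config.next, *]
  intro y
  by_cases hy : (D ⟨i, hi⟩ : ℕ) = y
  · simp [hy]
  · rw [Function.update_of_ne (by omega), hc, if_neg hy, Nat.add_zero]

/-- The invariant of the loop that computes the frequency of the second most frequent item. -/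
structure SecondInv [NeZero N] (ε : ℝ) (bot : Fin N) (D : Fin n → Fin N) (i : ℕ) (s : Config) :
    Prop where
  frame : Frame ε bot D s
  pc : s.pc = 19
  reg4 : s.reg 4 = i
  reg5 : s.reg 5 = mode D
  reg6 : s.reg 6 = occ₁ D
  reg13 : s.reg 13 = 0
  count : ∀ y : Fin N, s.mem (n + y) = if y = mode D then 0 else freq D y
  le_reg11 : ∀ j : Fin n, j < i → D j ≠ mode D → freq D (D j) ≤ s.reg 11
  reg11_le : s.reg 11 ≤ occ₂ D

/-- The counter of the mode is set to zero, so the next pass over the records can take a plain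
maximum of counters. -/
theorem reach_secondInv_zero [NeZero N] {s : Config} (hs : CountInv ε bot D n s) :
    Reach modeProgram τ s (SecondInv ε bot D 0) 4 := by
  obtain ⟨⟨h0, h1, h2, h3, h12, h17, hx0, hx9, hd, hm⟩, hpc, h4, h11, h13, hc, hmode⟩ := hs
  obtain ⟨pc, r, m, x, k⟩ := s
  dsimp only at *
  subst hpc
  obtain ⟨hlt, heq, hfl, hmin⟩ := hmode
  have hmd : mode D = ⟨r 5, hlt⟩ := by
    have hfreq : freq D ⟨r 5, hlt⟩ = r 6 := by rw [heq, ← prefixFreq_length]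
    refine mode_eq_of_forall (fun y => ?_) fun y hy => ?_
    · rw [hfreq, ← prefixFreq_length]; exact hfl y
    · rw [hfreq, ← prefixFreq_length] at hy
      exact hmin y y.2 hy
  have h5 : r 5 = mode D := by rw [hmd]
  have h6 : r 6 = occ₁ D := by rw [occ₁, heq, h5, prefixFreq_length]
  clear hmd
  refine Reach.jumpLE rfl (fun _ => ?_) fun h => absurd (h0.trans h4.symm).le h
  iterate 3 refine Reach.step rfl ?_
  refine Reach.done ?_
  constructor
  · constructor <;> simp [Instr.exec, Config.setReg, Config.next, *]
    intro j
    rw [Function.update_of_ne (by omega), hm]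
  · rfl
  iterate 4 simp [Instr.exec, Config.setReg, Config.next, h5, h6, h13]
  · intro y
    simp only [Instr.exec, Config.setReg, Config.next]
    by_cases hy : y = mode D
    · simp [hy, h5, h0, h12]
    · have : (y : ℕ) ≠ mode D := fun hcon => hy (Fin.ext hcon)
      simp [hy, h5, h0, h12, this, hc, prefixFreq_length]
  · simp
  · simp [Instr.exec, Config.setReg, Config.next, h11]

theorem reach_secondInv_succ [NeZero N] {i : ℕ} (hi : i < n) {s : Config}
    (hs : SecondInv ε bot D i s) : Reach modeProgram τ s (SecondInv ε bot D (i + 1)) 8 := by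
  obtain ⟨⟨h0, h1, h2, h3, h12, h17, hx0, hx9, hd, hm⟩, hpc, h4, h5, h6, h13, hc, hle, hge⟩ := hs
  obtain ⟨pc, r, m, x, k⟩ := s
  dsimp only at *
  subst hpc
  have hload : m i = D ⟨i, hi⟩ := hm ⟨i, hi⟩
  refine Reach.jumpLE rfl (fun h => by dsimp only at h; omega) fun _ => ?_
  iterate 3 refine Reach.step rfl ?_
  refine Reach.jumpLE rfl (fun h => ?_) fun h => ?_
  · simp [Instr.exec, Config.setReg, Config.next, h0, h4, hload, hc] at h
    iterate 2 refine Reach.step rfl ?_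
    refine Reach.done ?_
    constructor
    · constructor <;> simp [Instr.exec, Config.setReg, Config.next, *]
    · rfl
    iterate 4 simp [Instr.exec, Config.setReg, Config.next, *]
    · simp [Instr.exec, Config.setReg, Config.next, hc]
    · intro j hj hne
      rcases Nat.lt_succ_iff_lt_or_eq.1 hj with hj' | hj'
      · exact hle j hj' hne
      · obtain rfl : j = ⟨i, hi⟩ := Fin.ext hj'
        rw [if_neg hne] at h
        exact h
    · exact hge
  · simp [Instr.exec, Config.setReg, Config.next, h0, h4, hload, hc] at h
    iterate 3 refine Reach.step rfl ?_
    refine Reach.done ?_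
    have hne : D ⟨i, hi⟩ ≠ mode D := fun hcon => by simp [hcon] at h
    rw [if_neg hne] at h
    constructor
    · constructor <;> simp [Instr.exec, Config.setReg, Config.next, *]
    · rfl
    iterate 4 simp [Instr.exec, Config.setReg, Config.next, *]
    · simp [Instr.exec, Config.setReg, Config.next, hc]
    · intro j hj hne'
      simp [Instr.exec, Config.setReg, Config.next, h0, h4, hload, hc, hne, h12]
      rcases Nat.lt_succ_iff_lt_or_eq.1 hj with hj' | hj'
      · exact (hle j hj' hne').trans h.le
      · obtain rfl : j = ⟨i, hi⟩ := Fin.ext hj'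
        exact le_rfl
    · simp [Instr.exec, Config.setReg, Config.next, h0, h4, hload, hc, hne, h12]
      exact freq_le_occ₂ hne

/-- The invariant of the loop that computes the number of bits. -/
structure BitsInv [NeZero N] (ε : ℝ) (bot : Fin N) (D : Fin n → Fin N) (i : ℕ) (s : Config) :
    Prop where
  frame : Frame ε bot D s
  pc : s.pc = 28
  reg5 : s.reg 5 = mode D
  reg6 : s.reg 6 = occ₁ D
  reg11 : s.reg 11 = occ₂ D
  reg13 : s.reg 13 = i
  reg14 : s.reg 14 = 2 ^ i

theorem reach_bitsInv_zero [NeZero N] {s : Config} (hs : SecondInv ε bot D n s) :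
    Reach modeProgram τ s (BitsInv ε bot D 0) 2 := by
  obtain ⟨⟨h0, h1, h2, h3, h12, h17, hx0, hx9, hd, hm⟩, hpc, h4, h5, h6, h13, hc, hle, hge⟩ := hs
  obtain ⟨pc, r, m, x, k⟩ := s
  dsimp only at *
  subst hpc
  -- Items that do not occur contribute 0 to the maximum, and every other item is met among the
  -- records.
  have h11 : r 11 = occ₂ D := by
    refine le_antisymm hge (Finset.sup_le fun y hy => ?_)
    have hy' : y ≠ mode D := Finset.ne_of_mem_erase hy
    rcases Nat.eq_zero_or_pos (freq D y) with h | h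
    · omega
    · obtain ⟨j, hj⟩ := Finset.card_pos.1 h
      obtain rfl : D j = y := (Finset.mem_filter.1 hj).2
      exact hle j j.2 hy'
  refine Reach.jumpLE rfl (fun _ => ?_) fun h => absurd (h0.trans h4.symm).le h
  refine Reach.step rfl (Reach.done ?_)
  constructor
  · constructor <;> simp [Instr.exec, Config.setReg, Config.next, *]
  · rfl
  iterate 5 simp [Instr.exec, Config.setReg, Config.next, *]

theorem reach_bitsInv_succ [NeZero N] {i : ℕ} (hi : i < bits N) {s : Config}
    (hs : BitsInv ε bot D i s) : Reach modeProgram τ s (BitsInv ε bot D (i + 1)) 4 := by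
  obtain ⟨⟨h0, h1, h2, h3, h12, h17, hx0, hx9, hd, hm⟩, hpc, h5, h6, h11, h13, h14⟩ := hs
  obtain ⟨pc, r, m, x, k⟩ := s
  dsimp only at *
  subst hpc
  have hpow : 2 ^ i < N := (Nat.lt_clog_iff_pow_lt one_lt_two).1 hi
  refine Reach.jumpLE rfl (fun h => by dsimp only at h; omega) fun _ => ?_
  iterate 3 refine Reach.step rfl ?_
  refine Reach.done ?_
  constructor
  · constructor <;> simp [Instr.exec, Config.setReg, Config.next, *]
  · rfl
  iterate 4 simp [Instr.exec, Config.setReg, Config.next, *]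
  simp [Instr.exec, Config.setReg, Config.next, h14, pow_succ, mul_two]

end Program

/-- ⌈g/2⌉ = ⌊(g + 1)/2⌋ for natural g; truncated subtraction is exact because `occ₂ D ≤ occ₁ D`. -/
theorem instabilityDist_eq {n N : ℕ} [NeZero N] (D : Fin n → Fin N) :
    (instabilityDist D : ℝ) = ((occ₁ D - occ₂ D + 1) / 2 : ℕ) := by
  have h := occ₂_le_occ₁ D
  obtain ⟨g, hg⟩ := Nat.exists_eq_add_of_le h
  have key : instabilityDist D = ((occ₁ D - occ₂ D + 1) / 2 : ℕ) := by
    rw [instabilityDist, hg, Int.ceil_eq_iff, Nat.add_sub_cancel_left]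
    have h1 : 2 * ((g + 1) / 2) ≤ g + 1 := by omega
    have h2 : g ≤ 2 * ((g + 1) / 2) := by omega
    have h1' : 2 * (((g + 1) / 2 : ℕ) : ℝ) ≤ g + 1 := by exact_mod_cast h1
    have h2' : (g : ℝ) ≤ 2 * (((g + 1) / 2 : ℕ) : ℝ) := by exact_mod_cast h2
    rw [Int.cast_natCast]
    push_cast [-Nat.cast_ofNat] at *
    constructor <;> linarith
  rw [key, Int.cast_natCast]

/-- The output of the distance-to-instability test with noise `z`. -/
noncomputable def testedMode {n N : ℕ} [NeZero N] (ε : ℝ) (bot : Fin N) (D : Fin n → Fin N)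
    (z : ℝ) : Fin N :=
  if (instabilityDist D : ℝ) - 1 + z ≤ logInvDelta N ε / ε then bot else mode D

/-- What holds after the distance-to-instability test. -/
structure Tested {N : ℕ} (bot u : Fin N) (s : Config) : Prop where
  pc : s.pc = 53
  reg1 : s.reg 1 = N
  reg2 : s.reg 2 = bot
  reg3 : s.reg 3 = 1
  reg12 : s.reg 12 = 0
  reg13 : s.reg 13 = bits N
  reg14 : s.reg 14 = 2 ^ bits N
  reg15 : s.reg 15 = u
  reg17 : s.reg 17 = 0
  xreg1 : s.xreg 1 = bits N
  xreg2 : s.xreg 2 = 1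
  xreg3 : s.xreg 3 = 2
  xreg9 : s.xreg 9 = 0
  draws : s.draws = 1

/-- The bit that is computed from the `j`-th pair of random numbers. -/
noncomputable def noisyBit {N : ℕ} (u : Fin N) (τ : Tape) (j : ℕ) : Bool :=
  decide (1 / 2 ≤ (if (τ 1).1 ≤ (2 : ℝ)⁻¹ ^ bits N then (τ (2 * j + 2)).1
    else if (u : ℕ).testBit j then 1 else 0) + noiseScale (bits N) * (τ (2 * j + 3)).2)

/-- The invariant of the rounding loop. -/
structure RoundInv {N : ℕ} (bot u : Fin N) (τ : Tape) (i : ℕ) (s : Config) : Prop where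
  pc : s.pc = 70
  reg1 : s.reg 1 = N
  reg2 : s.reg 2 = bot
  reg3 : s.reg 3 = 1
  reg4 : s.reg 4 = i
  reg12 : s.reg 12 = 0
  reg13 : s.reg 13 = bits N
  reg15 : s.reg 15 = u / 2 ^ i
  reg16 : s.reg 16 = if (τ 1).1 ≤ (2 : ℝ)⁻¹ ^ bits N then 1 else 0
  reg17 : s.reg 17 = ∑ j ∈ Finset.range i, (noisyBit u τ j).toNat * 2 ^ j
  reg18 : s.reg 18 = 2 ^ i
  xreg7 : s.xreg 7 = noiseScale (bits N)
  xreg11 : s.xreg 11 = 1 / 2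
  draws : s.draws = 2 * i + 2

/-! ### Symbolic execution: the test, the noisy bits, the output -/

section Program

variable {n N : ℕ} {ε : ℝ} {bot : Fin N} {D : Fin n → Fin N} {τ : Tape}

theorem reach_tested [NeZero N] {s : Config} (hs : BitsInv ε bot D (bits N) s) :
    Reach modeProgram τ s (Tested bot (testedMode ε bot D ((τ 0).2 / ε))) 22 := by
  obtain ⟨⟨h0, h1, h2, h3, h12, h17, hx0, hx9, hd, hm⟩, hpc, h5, h6, h11, h13, h14⟩ := hs
  obtain ⟨pc, r, m, x, k⟩ := s
  dsimp only at *
  subst hpc hd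
  have hpow : N ≤ r 14 := h14 ▸ le_two_pow_bits N
  have hthr : (bits N : ℝ) * Real.log (2 * (bits N * bits N * bits N) / ε) / ε =
      logInvDelta N ε / ε := by
    rw [logInvDelta, show (bits N : ℝ) * bits N * bits N = (bits N : ℝ) ^ 3 by ring]
  have hinst := instabilityDist_eq D
  refine Reach.jumpLE rfl (fun _ => ?_) fun h => absurd (h1.trans_le hpow) h
  iterate 19 refine Reach.step rfl ?_
  refine Reach.jumpLER rfl (fun h => ?_) fun h => ?_
  · simp only [Instr.exec, Config.setReg, Config.setX, Config.next] at h
    simp [h3, h6, h11, h13, hx0, one_add_one_eq_two, hthr, ← hinst] at h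
    refine Reach.done ?_
    rw [testedMode, if_pos h]
    constructor
    · rfl
    all_goals
      simp [Instr.exec, Config.setReg, Config.setX, Config.next, one_add_one_eq_two, *]
  · simp only [Instr.exec, Config.setReg, Config.setX, Config.next] at h
    simp [h3, h6, h11, h13, hx0, one_add_one_eq_two, hthr, ← hinst] at h
    refine Reach.step rfl (Reach.done ?_)
    rw [testedMode, if_neg h.not_ge]
    constructor
    · rfl
    all_goals
      simp [Instr.exec, Config.setReg, Config.setX, Config.next, one_add_one_eq_two, *]

theorem reach_roundInv_zero {u : Fin N} {s : Config} (hs : Tested bot u s) :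
    Reach modeProgram τ s (RoundInv bot u τ 0) 17 := by
  obtain ⟨hpc, h1, h2, h3, h12, h13, h14, h15, h17, hx1, hx2, hx3, hx9, hd⟩ := hs
  obtain ⟨pc, r, m, x, k⟩ := s
  dsimp only at *
  subst hpc hd
  have h4 : (2 : ℝ) + 2 = 4 := by norm_num
  iterate 13 refine Reach.step rfl ?_
  refine Reach.jumpLER rfl (fun h => ?_) fun h => ?_
  · simp only [Instr.exec, Config.setReg, Config.setX, Config.next] at h
    simp [hx2, h14] at h
    iterate 2 refine Reach.step rfl ?_
    refine Reach.done ?_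
    constructor
    · rfl
    all_goals
      simp [Instr.exec, Config.setReg, Config.setX, Config.next, noiseScale, *]
  · simp only [Instr.exec, Config.setReg, Config.setX, Config.next] at h
    simp [hx2, h14] at h
    iterate 3 refine Reach.step rfl ?_
    refine Reach.done ?_
    constructor
    · rfl
    all_goals
      simp [Instr.exec, Config.setReg, Config.setX, Config.next, noiseScale, *]

/-- The lowest bit of x is x - 2⌊x/2⌋, computable by halving, addition and truncated subtraction. -/
theorem sub_half_add_half (u i : ℕ) :
    u / 2 ^ i - (u / 2 ^ i / 2 + u / 2 ^ i / 2) = (u.testBit i).toNat := by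
  rw [Nat.testBit_eq_decide_div_mod_eq]
  rcases Nat.mod_two_eq_zero_or_one (u / 2 ^ i) with h | h
  · simp [h]; omega
  · simp [h]; omega

/-- The common tail of the loop body, once register 6 holds the coordinate, whether it comes from
the vertex or from the uniform draw. -/
theorem reach_roundInv_of_point {u : Fin N} {i : ℕ} {s : Config} (hpc : s.pc = 78)
    (h1 : s.reg 1 = N) (h2 : s.reg 2 = bot) (h3 : s.reg 3 = 1) (h4 : s.reg 4 = i)
    (h8 : s.reg 8 = u / 2 ^ (i + 1)) (h12 : s.reg 12 = 0) (h13 : s.reg 13 = bits N)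
    (h16 : s.reg 16 = if (τ 1).1 ≤ (2 : ℝ)⁻¹ ^ bits N then 1 else 0)
    (h17 : s.reg 17 = ∑ j ∈ Finset.range i, (noisyBit u τ j).toNat * 2 ^ j)
    (h18 : s.reg 18 = 2 ^ i) (hx5 : s.xreg 5 = (τ (2 * i + 3)).2)
    (hx6 : s.xreg 6 = if (τ 1).1 ≤ (2 : ℝ)⁻¹ ^ bits N then (τ (2 * i + 2)).1
      else if (u : ℕ).testBit i then 1 else 0)
    (hx7 : s.xreg 7 = noiseScale (bits N)) (hx11 : s.xreg 11 = 1 / 2)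
    (hd : s.draws = 2 * i + 4) : Reach modeProgram τ s (RoundInv bot u τ (i + 1)) 8 := by
  obtain ⟨pc, r, m, x, k⟩ := s
  dsimp only at *
  subst hpc hd
  have hpow : 2 ^ i + 2 ^ i = 2 ^ (i + 1) := by rw [pow_succ, mul_two]
  have hbit : noisyBit u τ i = decide (1 / 2 ≤ x 6 + noiseScale (bits N) * (τ (2 * i + 3)).2) := by
    rw [noisyBit, hx6]
  have hdraws : 2 * i + 4 = 2 * (i + 1) + 2 := by ring
  clear hx6
  iterate 3 refine Reach.step rfl ?_
  refine Reach.jumpLER rfl (fun h => ?_) fun h => ?_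
  · simp only [Instr.exec, Config.setReg, Config.setX, Config.next] at h
    simp [hx5, hx7, hx11, -one_div] at h
    rw [decide_eq_true h] at hbit
    iterate 4 refine Reach.step rfl ?_
    refine Reach.done ?_
    constructor
    · rfl
    all_goals
      simp [Instr.exec, Config.setReg, Config.setX, Config.next, Finset.sum_range_succ, *]
  · simp only [Instr.exec, Config.setReg, Config.setX, Config.next] at h
    simp [hx5, hx7, hx11, -one_div] at h
    rw [decide_eq_false h.not_ge] at hbit
    iterate 4 refine Reach.step rfl ?_
    refine Reach.done ?_
    constructor
    · rfl
    all_goals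
      simp [Instr.exec, Config.setReg, Config.setX, Config.next, Finset.sum_range_succ, *]

theorem reach_roundInv_succ {u : Fin N} {i : ℕ} (hi : i < bits N) {s : Config}
    (hs : RoundInv bot u τ i s) : Reach modeProgram τ s (RoundInv bot u τ (i + 1)) 16 := by
  obtain ⟨hpc, h1, h2, h3, h4, h12, h13, h15, h16, h17, h18, hx7, hx11, hd⟩ := hs
  obtain ⟨pc, r, m, x, k⟩ := s
  dsimp only at *
  subst hpc hd
  have hbit := sub_half_add_half u i
  have hdiv : (u : ℕ) / 2 ^ i / 2 = u / 2 ^ (i + 1) := by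
    rw [Nat.div_div_eq_div_mul, pow_succ]
  rw [hdiv] at hbit
  refine Reach.jumpLE rfl (fun h => by dsimp only at h; omega) fun _ => ?_
  iterate 5 refine Reach.step rfl ?_
  refine Reach.jumpLE rfl (fun h => ?_) fun h => ?_
  · simp only [Instr.exec, Config.setReg, Config.setX, Config.next] at h
    simp [h3, h16] at h
    replace h : (τ 1).1 ≤ (2 ^ bits N)⁻¹ := by by_contra hc; simp [hc] at h
    refine Reach.mono (c := 8) ?_ (by norm_num)
    refine reach_roundInv_of_point rfl ?_ ?_ ?_ ?_ ?_ ?_ ?_ ?_ ?_ ?_ ?_ ?_ ?_ ?_ ?_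
    all_goals
      simp [Instr.exec, Config.setReg, Config.setX, Config.next, *]
  · simp only [Instr.exec, Config.setReg, Config.setX, Config.next] at h
    simp [h3, h16] at h
    refine Reach.step rfl ?_
    refine reach_roundInv_of_point rfl ?_ ?_ ?_ ?_ ?_ ?_ ?_ ?_ ?_ ?_ ?_ ?_ ?_ ?_ ?_
    all_goals
      simp [Instr.exec, Config.setReg, Config.setX, Config.next, h.not_ge, *]
    cases (u : ℕ).testBit i <;> simp

theorem ofBits_eq_sum {d : ℕ} (g : ℕ → Bool) :
    Nat.ofBits (fun j : Fin d => g j) = ∑ j ∈ Finset.range d, (g j).toNat * 2 ^ j := by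
  induction d generalizing g with
  | zero => simp
  | succ d ih =>
    rw [Nat.ofBits_succ, Finset.sum_range_succ']
    have := ih fun j => g (j + 1)
    simp only [Function.comp_def, Fin.val_succ, Fin.val_zero, pow_zero, mul_one] at this ⊢
    rw [this, Finset.mul_sum]
    congr 1
    exact Finset.sum_congr rfl fun j _ => by rw [pow_succ]; ring

theorem reach_output {u : Fin N} {s : Config} (hs : RoundInv bot u τ (bits N) s) :
    Reach modeProgram τ s (fun s' => Halted modeProgram s' ∧
      s'.reg 0 = decode bot fun j : Fin (bits N) => noisyBit u τ j) 4 := by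
  obtain ⟨hpc, h1, h2, h3, h4, h12, h13, h15, h16, h17, h18, hx7, hx11, hd⟩ := hs
  obtain ⟨pc, r, m, x, k⟩ := s
  dsimp only at *
  subst hpc
  rw [← ofBits_eq_sum] at h17
  refine Reach.jumpLE rfl (fun _ => ?_) fun h => absurd (h13.trans h4.symm).le h
  refine Reach.step rfl ?_
  refine Reach.jumpLE rfl (fun h => ?_) fun h => ?_
  · simp only [Instr.exec, Config.setReg, Config.next] at h
    simp [h1, h17] at h
    refine Reach.done ⟨le_rfl, ?_⟩
    simp [decode, h.not_gt, Instr.exec, Config.setReg, Config.next, h2, h12]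
  · simp only [Instr.exec, Config.setReg, Config.next] at h
    simp [h1, h17] at h
    refine Reach.step rfl (Reach.done ⟨le_rfl, ?_⟩)
    simp [decode, h, Instr.exec, Config.setReg, Config.next, h17, h12]

/-- The program computes the rounded noisy point in time linear in the number of records and of
bits. -/
theorem reach_modeProgram [NeZero N] :
    Reach modeProgram τ (input ε bot D) (fun s => Halted modeProgram s ∧
      s.reg 0 = decode bot fun j : Fin (bits N) =>
        noisyBit (testedMode ε bot D ((τ 0).2 / ε)) τ j)
      (1 + n * 15 + 4 + n * 8 + 2 + bits N * 4 + 22 + 17 + bits N * 16 + 4) :=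
  reach_countInv_zero
    |>.trans (fun _ => Reach.loop fun _ hi _ => reach_countInv_succ hi)
    |>.trans (fun _ => reach_secondInv_zero)
    |>.trans (fun _ => Reach.loop fun _ hi _ => reach_secondInv_succ hi)
    |>.trans (fun _ => reach_bitsInv_zero)
    |>.trans (fun _ => Reach.loop fun _ hi _ => reach_bitsInv_succ hi)
    |>.trans (fun _ => reach_tested)
    |>.trans (fun _ => reach_roundInv_zero)
    |>.trans (fun _ => Reach.loop fun _ hi _ => reach_roundInv_succ hi)
    |>.trans (fun _ => reach_output)

theorem run_modeProgram [NeZero N] (hN : 2 ≤ N) (ε : ℝ) (bot : Fin N) (D : Fin n → Fin N)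
    (τ : Tape) {T : ℕ} (hT : T = ⌊(200 : ℝ) * (n + Real.log N)⌋₊) :
    Halted modeProgram (run modeProgram τ (input ε bot D) T) ∧
      (run modeProgram τ (input ε bot D) T).reg 0 = decode bot fun j : Fin (bits N) =>
        noisyBit (testedMode ε bot D ((τ 0).2 / ε)) τ j := by
  obtain ⟨t, ht, hhalt, hout⟩ := reach_modeProgram (τ := τ) (ε := ε) (bot := bot) (D := D)
  have htT : t ≤ T := by
    rw [hT]
    refine Nat.le_floor ?_
    have h1 : (t : ℝ) ≤ 1 + n * 15 + 4 + n * 8 + 2 + bits N * 4 + 22 + 17 + bits N * 16 + 4 := by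
      exact_mod_cast ht
    have h2 := bits_le_three_mul_log hN
    have h3 : Real.log 2 ≤ Real.log N := Real.log_le_log (by norm_num) (by exact_mod_cast hN)
    have h4 := two_thirds_lt_log_two
    have h5 : (0 : ℝ) ≤ n := Nat.cast_nonneg n
    -- The bound is 23n + 20d + 50, where 20d ≤ 60 log N and 50 ≤ 75 log N because log N ≥ log 2 >
    -- 2/3.
    linarith
  rw [run_of_halted htT hhalt]
  exact ⟨hhalt, hout⟩

end Program

/-! ### The law of the output of the program -/

/-- The uniform distribution on the unit interval. -/
noncomputable abbrev unitUniform : Measure ℝ := volume.restrict (Set.Icc 0 1)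

instance : IsProbabilityMeasure unitUniform := ⟨by simp⟩

/-- The numbers on the tape that the program reads. -/
def readTape (d : ℕ) (τ : Tape) : (ℝ × ℝ × (Fin d → ℝ)) × (Fin d → ℝ) :=
  (((τ 0).2, (τ 1).1, fun j => (τ (2 * j + 2)).1), fun j => (τ (2 * j + 3)).2)

/-- Distinct tape entries are independent, and only one component of each is read. -/
theorem measurePreserving_pi_of_injective {ι : Type*} [Fintype ι] {f : ι → ℕ}
    (hf : Function.Injective f) {g : ι → ℝ × ℝ → ℝ} {ρ : ι → Measure ℝ}
    (hg : ∀ i, MeasurePreserving (g i) (unitUniform.prod (laplace 1)) (ρ i)) :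
    MeasurePreserving (fun (τ : Tape) i => g i (τ (f i))) tapeLaw (Measure.pi ρ) := by
  have h1 : MeasurePreserving (fun (τ : Tape) i => τ (f i)) tapeLaw
      (Measure.pi fun _ : ι => unitUniform.prod (laplace 1)) := by
    refine ⟨by fun_prop, ?_⟩
    rw [tapeLaw, Measure.map_infinitePi_infinitePi_of_inj hf, Measure.infinitePi_eq_pi]
  have : ∀ i, IsProbabilityMeasure (ρ i) := fun i => by
    rw [← (hg i).map_eq]
    exact Measure.isProbabilityMeasure_map (hg i).measurable.aemeasurable
  exact (measurePreserving_pi _ _ hg).comp h1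

/-- The nested sum type indexes the numbers read in the bracketing of the target product, so the
product measure over it is split by repeated use of `measurePreserving_sumPiEquivProdPi`. -/
theorem measurePreserving_readTape (d : ℕ) :
    MeasurePreserving (readTape d) tapeLaw
      (((laplace 1).prod (unitUniform.prod (Measure.pi fun _ : Fin d => unitUniform))).prod
        (Measure.pi fun _ : Fin d => laplace 1)) := by
  let f : (Unit ⊕ (Unit ⊕ Fin d)) ⊕ Fin d → ℕ :=
    Sum.elim (Sum.elim (fun _ => 0) (Sum.elim (fun _ => 1) fun j => 2 * j + 2)) fun j => 2 * j + 3
  let g : (Unit ⊕ (Unit ⊕ Fin d)) ⊕ Fin d → ℝ × ℝ → ℝ :=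
    Sum.elim (Sum.elim (fun _ => Prod.snd) (Sum.elim (fun _ => Prod.fst) fun _ => Prod.fst))
      fun _ => Prod.snd
  let ρ : (Unit ⊕ (Unit ⊕ Fin d)) ⊕ Fin d → Measure ℝ :=
    Sum.elim (Sum.elim (fun _ => laplace 1) (Sum.elim (fun _ => unitUniform) fun _ => unitUniform))
      fun _ => laplace 1
  have hρ : ∀ i, IsProbabilityMeasure (ρ i) := by
    rintro ((i | i | i) | i) <;> simp only [ρ, Sum.elim_inl, Sum.elim_inr] <;> infer_instance
  have hf : Function.Injective f := by
    rintro ((i | i | i) | i) ((j | j | j) | j) h <;>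
      simp only [f, Sum.elim_inl, Sum.elim_inr] at h <;>
      first
        | rfl
        | omega
        | (congr 2; done)
        | (simp only [Sum.inl.injEq, Sum.inr.injEq, Fin.ext_iff]; omega)
  have hg : ∀ i, MeasurePreserving (g i) (unitUniform.prod (laplace 1)) (ρ i) := by
    rintro ((i | i | i) | i)
    · exact measurePreserving_snd
    · exact measurePreserving_fst
    · exact measurePreserving_fst
    · exact measurePreserving_snd
  have h0 := measurePreserving_pi_of_injective hf hg
  have hu : ∀ μ : Measure ℝ, MeasurePreserving (MeasurableEquiv.funUnique Unit ℝ)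
      (Measure.pi fun _ : Unit => μ) μ := fun μ => measurePreserving_funUnique μ Unit
  have e1 := measurePreserving_sumPiEquivProdPi (X := fun _ => ℝ) ρ
  have e2 := measurePreserving_sumPiEquivProdPi (X := fun _ => ℝ) fun i => ρ (Sum.inl i)
  have e3 := measurePreserving_sumPiEquivProdPi (X := fun _ => ℝ)
    fun i => ρ (Sum.inl (Sum.inr i))
  have k3 := ((hu unitUniform).prod
    (MeasurePreserving.id (Measure.pi fun _ : Fin d => unitUniform))).comp e3
  have k2 := ((hu (laplace 1)).prod k3).comp e2
  have k1 := (k2.prod (MeasurePreserving.id (Measure.pi fun _ : Fin d => laplace 1))).comp e1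
  exact k1.comp h0

theorem pi_unitUniform (d : ℕ) :
    (Measure.pi fun _ : Fin d => unitUniform) = volume.restrict (Set.Icc 0 1) := by
  rw [← Set.pi_univ_Icc, volume_pi, Measure.restrict_pi_pi]
  rfl

theorem pi_laplace_eq_map (d : ℕ) {b : ℝ} (hb : 0 < b) :
    (Measure.pi fun _ : Fin d => laplace b) =
      (Measure.pi fun _ : Fin d => laplace 1).map fun l i => b * l i := by
  have := isProbabilityMeasure_laplace hb
  have h : MeasurePreserving (fun x : ℝ => b * x) (laplace 1) (laplace b) :=
    ⟨by fun_prop, (laplace_eq_map hb).symm⟩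
  exact (measurePreserving_pi _ _ fun _ : Fin d => h).map_eq.symm

theorem measurable_mixture {α β : Type*} [MeasurableSpace α] [MeasurableSpace β] {φ : α → β}
    (hφ : Measurable φ) (ω : ℝ) :
    Measurable fun p : α × ℝ × β => if p.2.1 ≤ ω then p.2.2 else φ p.1 :=
  Measurable.ite (measurableSet_le (by fun_prop) measurable_const) (by fun_prop) (by fun_prop)

/-- A mixture is sampled by drawing a uniform random number first. -/
theorem map_mixture {α β : Type*} [MeasurableSpace α] [MeasurableSpace β] {φ : α → β}
    (hφ : Measurable φ) {ω : ℝ} (hω0 : 0 ≤ ω) (hω1 : ω ≤ 1) (μ : Measure α) (ν : Measure β)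
    [IsProbabilityMeasure μ] [IsProbabilityMeasure ν] :
    (μ.prod (unitUniform.prod ν)).map (fun p => if p.2.1 ≤ ω then p.2.2 else φ p.1) =
      ENNReal.ofReal (1 - ω) • μ.map φ + ENNReal.ofReal ω • ν := by
  ext s hs
  have hpre : (fun p : α × ℝ × β => if p.2.1 ≤ ω then p.2.2 else φ p.1) ⁻¹' s =
      (φ ⁻¹' s) ×ˢ (Set.Ioi ω ×ˢ Set.univ) ∪ Set.univ ×ˢ (Set.Iic ω ×ˢ s) := by
    ext ⟨z, a, v⟩
    by_cases h : a ≤ ω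
    · simp [h]
    · simp [h, not_le.1 h]
  have hdisj : Disjoint ((φ ⁻¹' s) ×ˢ (Set.Ioi ω ×ˢ (Set.univ : Set β)))
      (Set.univ ×ˢ (Set.Iic ω ×ˢ s)) := by
    rw [Set.disjoint_left]
    rintro ⟨z, a, v⟩ h1 h2
    exact (Set.mem_Ioi.1 h1.2.1).not_ge h2.2.1
  have h1 : unitUniform (Set.Ioi ω) = ENNReal.ofReal (1 - ω) := by
    rw [Measure.restrict_apply measurableSet_Ioi]
    have : Set.Ioi ω ∩ Set.Icc 0 1 = Set.Ioc ω 1 := by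
      ext x
      simp only [Set.mem_inter_iff, Set.mem_Ioi, Set.mem_Icc, Set.mem_Ioc]
      constructor
      · rintro ⟨h1, h2, h3⟩; exact ⟨h1, h3⟩
      · rintro ⟨h1, h3⟩; exact ⟨h1, by linarith, h3⟩
    rw [this, Real.volume_Ioc]
  have h2 : unitUniform (Set.Iic ω) = ENNReal.ofReal ω := by
    rw [Measure.restrict_apply measurableSet_Iic]
    have : Set.Iic ω ∩ Set.Icc 0 1 = Set.Icc 0 ω := by
      ext x
      simp only [Set.mem_inter_iff, Set.mem_Iic, Set.mem_Icc]
      constructor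
      · rintro ⟨h1, h2, h3⟩; exact ⟨h2, h1⟩
      · rintro ⟨h1, h3⟩; exact ⟨h3, h1, by linarith⟩
    rw [this, Real.volume_Icc, sub_zero]
  rw [Measure.map_apply (measurable_mixture hφ ω) hs, hpre,
    measure_union hdisj (MeasurableSet.univ.prod (measurableSet_Iic.prod hs)),
    Measure.prod_prod, Measure.prod_prod, Measure.prod_prod, Measure.prod_prod, h1, h2]
  simp [Measure.map_apply hφ hs, mul_comm]

section Law

variable {n N : ℕ} [NeZero N] {ε : ℝ}

theorem approxMode_eq_map (hε : 0 < ε) (bot : Fin N) (D : Fin n → Fin N) :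
    approxMode ε bot D = (laplace 1).map fun z => testedMode ε bot D (z / ε) := by
  rw [approxMode, laplace_eq_map (b := 1 / ε) (by positivity),
    Measure.map_map (measurable_test ε bot D) (by fun_prop)]
  congr 1
  ext z
  simp [testedMode, div_eq_inv_mul]

theorem measurePreserving_output (hN : 2 ≤ N) (hε : 0 < ε) (bot : Fin N) (D : Fin n → Fin N) :
    MeasurePreserving (fun τ => decode bot fun j : Fin (bits N) =>
        noisyBit (testedMode ε bot D ((τ 0).2 / ε)) τ j) tapeLaw (modeRelease ε bot D) := by
  have hb := noiseScale_pos (bits_pos hN)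
  have := isProbabilityMeasure_laplace hb
  have hbin : Measurable (binMap (N := N)) := measurable_of_finite _
  have htest : Measurable fun z : ℝ => testedMode ε bot D (z / ε) :=
    (measurable_test ε bot D).comp (measurable_id.div_const ε)
  have hφ : Measurable fun z : ℝ => binMap (testedMode ε bot D (z / ε)) := hbin.comp htest
  have hscale : Measurable fun (l : Fin (bits N) → ℝ) i => noiseScale (bits N) * l i := by
    fun_prop
  have hdec : Measurable fun z : Fin (bits N) → ℝ => decode bot (roundCube z) :=
    (measurable_of_finite (decode bot)).comp measurable_roundCube
  have hadd : Measurable fun p : (Fin (bits N) → ℝ) × (Fin (bits N) → ℝ) => p.1 + p.2 := by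
    fun_prop
  have hω1 : (2 : ℝ)⁻¹ ^ bits N ≤ 1 := pow_le_one₀ (by norm_num) (by norm_num)
  have hmix := measurable_mixture hφ ((2 : ℝ)⁻¹ ^ bits N)
  have hread := measurePreserving_readTape (bits N)
  have hpoint := hadd.comp (hmix.prodMap hscale)
  -- The output factors through the numbers read: choose the point by the mixture, add the scaled
  -- noise, round, decode. Pushing the law through these maps reproduces the definition of
  -- `modeRelease`.
  have heq : (fun τ : Tape => decode bot fun j : Fin (bits N) =>
      noisyBit (testedMode ε bot D ((τ 0).2 / ε)) τ j) =
      ((fun z => decode bot (roundCube z)) ∘ ((fun p => p.1 + p.2) ∘ Prod.map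
        (fun p : ℝ × ℝ × (Fin (bits N) → ℝ) => if p.2.1 ≤ (2 : ℝ)⁻¹ ^ bits N then p.2.2
          else binMap (testedMode ε bot D (p.1 / ε)))
        fun l i => noiseScale (bits N) * l i)) ∘ readTape (bits N) := by
    ext τ
    simp only [Function.comp_def, readTape, Prod.map, noisyBit]
    congr 3
    ext j
    by_cases h : (τ 1).1 ≤ (2 : ℝ)⁻¹ ^ bits N
    · simp only [roundCube, h, if_true]; rfl
    · simp only [roundCube, h, if_false]; rfl
  rw [heq]
  refine ⟨(hdec.comp hpoint).comp hread.measurable, ?_⟩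
  rw [modeRelease, purifyDiscrete, purify, two_mul_purifyDelta_div hN hε, cond_volume_unitCube,
    ← pi_unitUniform, approxMode_eq_map hε, Measure.map_map hbin htest, Function.comp_def binMap,
    ← map_mixture hφ (by positivity) hω1, pi_laplace_eq_map _ hb, Measure.conv,
    Measure.map_prod_map _ _ hmix hscale, ← hread.map_eq,
    Measure.map_map hadd (hmix.prodMap hscale), Measure.map_map hdec hpoint,
    Measure.map_map (hdec.comp hpoint) hread.measurable]

theorem computesWithin_modeProgram (hN : 2 ≤ N) (hε : 0 < ε) (bot : Fin N) (D : Fin n → Fin N) :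
    ComputesWithin modeProgram ε bot D ⌊(200 : ℝ) * (n + Real.log N)⌋₊
      (modeRelease ε bot D) := by
  refine ⟨fun τ => (run_modeProgram hN ε bot D τ rfl).1, ?_⟩
  simp only [(run_modeProgram hN ε bot D _ rfl).2]
  have h := measurePreserving_output hN hε bot D
  rw [← h.map_eq, Measure.map_map (measurable_of_finite _) h.measurable]
  rfl

end Law

end ModeRelease

open ModeRelease in
theorem theorem7 :
    (∀ (N : ℕ) [NeZero N] (n : ℕ) (ε : ℝ) (bot : Fin N), 2 ≤ N → 0 < ε →
      IsDP (2 * ε) 0 (fun D : Fin n → Fin N => modeRelease ε bot D)) ∧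
    (∃ (P : List Instr) (C : ℝ), ∀ (N : ℕ) [NeZero N] (n : ℕ) (ε : ℝ) (bot : Fin N)
      (D : Fin n → Fin N), 2 ≤ N → 0 < ε →
      ComputesWithin P ε bot D ⌊C * (n + Real.log N)⌋₊ (modeRelease ε bot D)) ∧
    (∃ K : ℝ, ∀ ε₀ c : ℝ, 0 < ε₀ → 1 < c → ∃ C : ℝ, ∀ (N : ℕ) [NeZero N] (n : ℕ) (ε : ℝ)
      (bot : Fin N) (D : Fin n → Fin N), 2 ≤ N → 0 < ε → ε ≤ ε₀ → c * ε ≤ Real.log N →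
      C * (Real.log N * Real.log (Real.log N / ε) / ε) < (occ₁ D : ℝ) - occ₂ D →
      1 - K / N ≤ (modeRelease ε bot D).real {mode D}) :=
  ⟨fun _ _ _ _ bot hN hε => isDP_modeRelease hN hε bot,
    ⟨modeProgram, 200, fun _ _ _ _ bot D hN hε => computesWithin_modeProgram hN hε bot D⟩,
    ⟨2 + Real.exp 16, fun _ _ _ hc => exists_utility_constant hc⟩⟩
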